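/- Let $r,s\ge 0$, let $\Delta=(v_1,\dots,v_n)$ be a family of vectors in $\mathbb Z^2\setminus\{0\}$ and let $F\subset\{1,\dots,n\}$ with $r+2s+|F|=n-1$. **Curves.** A connected oriented $(r,s)$-marked curve of degree $\Delta$ with set of fixed ends $F$ is a plane tropical curve $(\Gamma,h)$ with $\Gamma$ a metric tree whose vertices have valence at least three and whose unbounded edges are $r$ labelled real markings and $s$ labelled complex markings (contracted by $h$) and $n$ labelled ends $y_1,\dots,y_n$, on which $h$ has directions $v_1,\dots,v_n$; $h$ is affine with integer direction vectors on edges and balanced at all vertices; and each unmarked edge carries an orientation, the end $y_i$ being oriented inwards if and only if $i\in F$. Curves are taken up to isomorphism. The weight $w$ of an edge is the gcd of the entries of its direction vector, and an edge is even or odd according to its weight. The Mikhalkin multiplicity $a$ of a vertex with three adjacent unmarked edges is the absolute value of the determinant of two of their direction vectors. The evaluation map $\mathrm{ev}$ sends a curve to the images in $\mathbb R^2$ of its markings and to the images in $\mathbb R^2/\langle v_i\rangle$ of its fixed ends $y_i$, $i\in F$. **Broccoli curves** have only vertices of the following types (apart from markings, only unmarked edges are listed), with multiplicity $m_V$: (1)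 a real marking and two outgoing odd edges, $m_V=1$; (2) no marking, two incoming and one outgoing odd edges, $m_V=\mathrm i^{a-1}$; (3) no marking, an incoming even, an incoming odd and an outgoing odd edge, $m_V=a\,\mathrm i^{a-1}$; (4) no marking, two incoming and one outgoing even edges, $m_V=a\,\mathrm i^{a-1}$; (5) a complex marking and three outgoing odd edges, $m_V=a\,\mathrm i^{a-1}$; (6) a complex marking, two outgoing odd edges and one outgoing even edge, $m_V=\mathrm i^{a-1}$. The multiplicity is $m_C=\prod_{k=1}^n \mathrm i^{w(y_k)-1}\prod_V m_V$. **Oriented refined broccoli curves** have only vertices of the following types, with edges of any parity: (I) a real marking and two outgoing edges, $m_V(y)=1$; (II) no marking, two incoming edges and one outgoing edge, $m_V(y)=\frac{y^{a/2}-y^{-a/2}}{y^{1/2}-y^{-1/2}}$; (III) a complex marking and three outgoing edges, $m_V(y)=\frac{y^{a/2}+y^{-a/2}}{y^{1/2}+y^{-1/2}}$. The refined multiplicity is $m_C(y)=\prod_{i=1}^n m_{y_i}(y)\prod_V m_V(y)$, where, with $w=w(y_i)$, $m_{y_i}(y)=\frac{y^{w/2}+(-1)^w y^{-w/2}}{y^{1/2}+(-1)^w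 y^{-1/2}}$ for $i\in F$ and $m_{y_i}(y)=\frac{y^{w/2}-(-1)^w y^{-w/2}}{w\,(y^{1/2}-(-1)^w y^{-1/2})}$ for $i\notin F$. **Invariants.** Let $M^{B}$ and $M^{rB}$ be the closures of the sets of broccoli curves and of oriented refined broccoli curves in the moduli space of connected oriented $(r,s)$-marked curves of degree $\Delta$ with set of fixed ends $F$, polyhedral complexes whose cells correspond to combinatorial types. Conditions $\mathcal P\in(\mathbb R^2)^{r+s}\times\prod_{i\in F}\mathbb R^2/\langle v_i\rangle$ are in general position for $\mathrm{ev}$ on such a complex if they do not lie in the image of any cell whose image has dimension less than $2(r+s)+|F|$. Let $G(\Delta,F)$ be the group of permutations $\sigma$ of $\{1,\dots,n\}$ with $\sigma(i)=i$ for $i\in F$ and $v_{\sigma(i)}=v_i$ for all $i$. Put $$N^{B}_{(r,s)}(\Delta,F,\mathcal P)=\frac1{|G(\Delta,F)|}\sum_C m_C,\qquad N^{rB}_{(r,s)}(y,\Delta,F,\mathcal P)=\frac1{|G(\Delta,F)|}\sum_C m_C(y),$$ the sums running over the isomorphism classes of broccoli curves in $M^{B}$, respectively of oriented refined broccoli curves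 in $M^{rB}$, with $\mathrm{ev}(C)=\mathcal P$. **Statement.** Let $\mathcal P$ be in general position for $\mathrm{ev}$ on $M^{rB}$. Then $\mathcal P$ is in general position for $\mathrm{ev}$ on $M^{B}$, both sums are finite, the oriented refined broccoli invariant $N^{rB}_{(r,s)}(y,\Delta,F,\mathcal P)$ is a Laurent polynomial in $y$ with rational coefficients, and its value at $y=-1$ is the broccoli invariant: $N^{rB}_{(r,s)}(-1,\Delta,F,\mathcal P)=N^{B}_{(r,s)}(\Delta,F,\mathcal P)$. -/

import Mathlib

namespace Broccoli

/-- An integer direction vector, viewed in `ℝ²`. -/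
def toReal (v : ℤ × ℤ) : ℝ × ℝ := ((v.1 : ℝ), (v.2 : ℝ))

/-- The weight of an edge with direction vector `v`: the gcd of the entries of `v`.
An edge is even (odd) if its weight is. -/
def weight (v : ℤ × ℤ) : ℕ := Int.gcd v.1 v.2

/-- The absolute value of the determinant of two integer vectors. -/
def absDet (v w : ℤ × ℤ) : ℕ := (v.1 * w.2 - v.2 * w.1).natAbs

/-- A connected oriented `(r,s)`-marked plane tropical rational parametrized curve
`(Γ, h)` of degree `Δ = (v(y_1), …, v(y_n))` with set of fixed ends `F`.

`Γ` is a metric tree with vertices `Fin k` and bounded edges given by `G`, and with labelled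
unbounded edges: real markings (`Fin r`), complex markings (`Fin s`) and ends `y_i` (`Fin n`).
The map `h` is given by the images `pos` of the vertices; it contracts the markings, has
direction `Δ i` on the end `y_i` (pointing away from the vertex), and the integer direction
vector `dir u v` on the bounded edge from `u` to `v`.
An orientation of a bounded edge is recorded by `orient u v` (it points from `u` to `v`);
the end `y_i` is oriented inwards if `i ∈ F` and outwards otherwise.
The values of `len`, `dir`, `orient` on pairs of vertices that are not adjacent are irrelevant. -/
structure OrientedCurve (r s : ℕ) {n : ℕ} (Δ : Fin n → ℤ × ℤ) (F : Finset (Fin n)) where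
  /-- number of vertices -/
  k : ℕ
  /-- the graph of bounded edges -/
  G : SimpleGraph (Fin k)
  isTree : G.IsTree
  /-- the vertex to which the end `y_i` is attached -/
  endAt : Fin n → Fin k
  /-- the vertex to which a real marking is attached -/
  realAt : Fin r → Fin k
  /-- the vertex to which a complex marking is attached -/
  cplxAt : Fin s → Fin k
  /-- every vertex of `Γ` has valence at least three -/
  stable : ∀ v, 3 ≤ Nat.card {u // G.Adj v u} + Nat.card {i // endAt i = v}
    + Nat.card {i // realAt i = v} + Nat.card {i // cplxAt i = v}
  /-- lengths of the bounded edges -/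
  len : Fin k → Fin k → ℝ
  len_pos : ∀ u v, G.Adj u v → 0 < len u v
  len_symm : ∀ u v, G.Adj u v → len v u = len u v
  /-- direction vectors of the bounded edges -/
  dir : Fin k → Fin k → ℤ × ℤ
  dir_symm : ∀ u v, G.Adj u v → dir v u = - dir u v
  /-- the image of a vertex under `h` -/
  pos : Fin k → ℝ × ℝ
  /-- `h` is affine linear on the bounded edges, with the given direction vectors -/
  affine : ∀ u v, G.Adj u v → pos v - pos u = len u v • toReal (dir u v)
  /-- the balancing condition -/
  balanced : ∀ v, ∑ᶠ u ∈ {u | G.Adj v u}, dir v u + ∑ᶠ i ∈ {i | endAt i = v}, Δ i = 0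
  /-- orientations of the bounded edges -/
  orient : Fin k → Fin k → Prop
  orient_iff : ∀ u v, G.Adj u v → (orient v u ↔ ¬ orient u v)

/-- Conditions: points `P_j ∈ ℝ²` for the real and for the complex markings, and lines
`Q_i ∈ ℝ² / ⟨v(y_i)⟩` for the fixed ends. -/
abbrev Conditions (r s : ℕ) {n : ℕ} (Δ : Fin n → ℤ × ℤ) (F : Finset (Fin n)) : Type :=
  (Fin r → ℝ × ℝ) × (Fin s → ℝ × ℝ) ×
    ((i : F) → (ℝ × ℝ) ⧸ Submodule.span ℝ {toReal (Δ i)})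

/-- The group `G(Δ,F)` of all permutations of the labels of the ends that fix `F` pointwise and
preserve the direction vectors. -/
def symGroup {n : ℕ} (Δ : Fin n → ℤ × ℤ) (F : Finset (Fin n)) :
    Subgroup (Equiv.Perm (Fin n)) where
  carrier := {σ | (∀ i ∈ F, σ i = i) ∧ ∀ i, Δ (σ i) = Δ i}
  mul_mem' := by
    rintro σ τ ⟨h1, h2⟩ ⟨h3, h4⟩
    refine ⟨fun i hi => ?_, fun i => ?_⟩
    · rw [Equiv.Perm.mul_apply, h3 i hi, h1 i hi]
    · rw [Equiv.Perm.mul_apply, h2, h4]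
  one_mem' := ⟨fun _ _ => rfl, fun _ => rfl⟩
  inv_mem' := by
    rintro σ ⟨h1, h2⟩
    refine ⟨fun i hi => ?_, fun i => ?_⟩
    · rw [Equiv.Perm.inv_eq_iff_eq, h1 i hi]
    · simpa using (h2 (σ⁻¹ i)).symm

namespace OrientedCurve

variable {r s n : ℕ} {Δ : Fin n → ℤ × ℤ} {F : Finset (Fin n)}

/-- The evaluation map `ev_F`. -/
def ev (C : OrientedCurve r s Δ F) : Conditions r s Δ F :=
  (fun j => C.pos (C.realAt j), fun j => C.pos (C.cplxAt j),
    fun i => Submodule.Quotient.mk (C.pos (C.endAt i)))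

/-! ### Combinatorial types and isomorphisms -/

/-- `σ` identifies the combinatorial types of `C` and `D`, i.e. all data except for the lengths
of the bounded edges and the position in the plane. -/
structure IsTypeIso (C D : OrientedCurve r s Δ F) (σ : Fin C.k ≃ Fin D.k) : Prop where
  adj : ∀ u v, D.G.Adj (σ u) (σ v) ↔ C.G.Adj u v
  endAt : ∀ i, D.endAt i = σ (C.endAt i)
  realAt : ∀ i, D.realAt i = σ (C.realAt i)
  cplxAt : ∀ i, D.cplxAt i = σ (C.cplxAt i)
  dir : ∀ u v, C.G.Adj u v → D.dir (σ u) (σ v) = C.dir u v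
  orient : ∀ u v, C.G.Adj u v → (D.orient (σ u) (σ v) ↔ C.orient u v)

/-- `C` and `D` have the same combinatorial type. -/
def SameType (C D : OrientedCurve r s Δ F) : Prop :=
  ∃ σ : Fin C.k ≃ Fin D.k, IsTypeIso C D σ

/-- `C` and `D` are isomorphic. -/
def Isom (C D : OrientedCurve r s Δ F) : Prop :=
  ∃ σ : Fin C.k ≃ Fin D.k, IsTypeIso C D σ ∧
    (∀ u v, C.G.Adj u v → D.len (σ u) (σ v) = C.len u v) ∧ ∀ u, D.pos (σ u) = C.pos u

theorem IsTypeIso.refl (C : OrientedCurve r s Δ F) : IsTypeIso C C (Equiv.refl _) :=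
  ⟨fun _ _ => Iff.rfl, fun _ => rfl, fun _ => rfl, fun _ => rfl, fun _ _ _ => rfl,
    fun _ _ _ => Iff.rfl⟩

theorem IsTypeIso.symm {C D : OrientedCurve r s Δ F} {σ : Fin C.k ≃ Fin D.k}
    (h : IsTypeIso C D σ) : IsTypeIso D C σ.symm where
  adj u v := by rw [← h.adj]; simp
  endAt i := by rw [h.endAt]; simp
  realAt i := by rw [h.realAt]; simp
  cplxAt i := by rw [h.cplxAt]; simp
  dir u v huv := by
    rw [← h.dir _ _ (by rw [← h.adj]; simpa using huv)]; simp
  orient u v huv := by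
    rw [← h.orient _ _ (by rw [← h.adj]; simpa using huv)]; simp

theorem IsTypeIso.trans {C D E : OrientedCurve r s Δ F} {σ : Fin C.k ≃ Fin D.k}
    {τ : Fin D.k ≃ Fin E.k} (h : IsTypeIso C D σ) (h' : IsTypeIso D E τ) :
    IsTypeIso C E (σ.trans τ) where
  adj u v := by simp [h'.adj, h.adj]
  endAt i := by simp [h'.endAt, h.endAt]
  realAt i := by simp [h'.realAt, h.realAt]
  cplxAt i := by simp [h'.cplxAt, h.cplxAt]
  dir u v huv := by simp [h'.dir _ _ ((h.adj u v).2 huv), h.dir _ _ huv]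
  orient u v huv := by simp [h'.orient _ _ ((h.adj u v).2 huv), h.orient _ _ huv]

/-- Isomorphism of oriented marked curves, as an equivalence relation. -/
instance setoid (r s : ℕ) {n : ℕ} (Δ : Fin n → ℤ × ℤ) (F : Finset (Fin n)) :
    Setoid (OrientedCurve r s Δ F) where
  r := Isom
  iseqv :=
    { refl := fun C => ⟨Equiv.refl _, IsTypeIso.refl C, fun _ _ _ => rfl, fun _ => rfl⟩
      symm := by
        rintro C D ⟨σ, h, hl, hp⟩
        refine ⟨σ.symm, h.symm, fun u v huv => ?_, fun u => ?_⟩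
        · rw [← hl _ _ (by rw [← h.adj]; simpa using huv)]; simp
        · rw [← hp]; simp
      trans := by
        rintro C D E ⟨σ, h, hl, hp⟩ ⟨τ, h', hl', hp'⟩
        refine ⟨σ.trans τ, h.trans h', fun u v huv => ?_, fun u => ?_⟩
        · simp [hl' _ _ ((h.adj u v).2 huv), hl _ _ huv]
        · simp [hp', hp] }

/-! ### Vertex types -/

open scoped Classical in
/-- The unmarked edges adjacent to the vertex `v`: bounded edges (recorded by their other
vertex) and ends. -/
noncomputable def edgesAt (C : OrientedCurve r s Δ F) (v : Fin C.k) : Finset (Fin C.k ⊕ Fin n) :=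
  Finset.univ.filter (Sum.elim (fun u => C.G.Adj v u) (fun i => C.endAt i = v))

/-- The direction vector of an unmarked edge at `v`, pointing away from `v`. -/
def dirAt (C : OrientedCurve r s Δ F) (v : Fin C.k) : Fin C.k ⊕ Fin n → ℤ × ℤ :=
  Sum.elim (fun u => C.dir v u) Δ

/-- An unmarked edge at `v` is outgoing at `v` if its orientation points away from `v`. -/
def IsOutgoing (C : OrientedCurve r s Δ F) (v : Fin C.k) : Fin C.k ⊕ Fin n → Prop :=
  Sum.elim (fun u => C.orient v u) (fun i => i ∉ F)

open scoped Classical in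
/-- The number of outgoing odd edges at `v`. -/
noncomputable def outOdd (C : OrientedCurve r s Δ F) (v : Fin C.k) : ℕ :=
  ((C.edgesAt v).filter fun e => C.IsOutgoing v e ∧ Odd (weight (C.dirAt v e))).card

open scoped Classical in
/-- The number of outgoing even edges at `v`. -/
noncomputable def outEven (C : OrientedCurve r s Δ F) (v : Fin C.k) : ℕ :=
  ((C.edgesAt v).filter fun e => C.IsOutgoing v e ∧ Even (weight (C.dirAt v e))).card

open scoped Classical in
/-- The number of incoming odd edges at `v`. -/
noncomputable def inOdd (C : OrientedCurve r s Δ F) (v : Fin C.k) : ℕ :=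
  ((C.edgesAt v).filter fun e => ¬ C.IsOutgoing v e ∧ Odd (weight (C.dirAt v e))).card

open scoped Classical in
/-- The number of incoming even edges at `v`. -/
noncomputable def inEven (C : OrientedCurve r s Δ F) (v : Fin C.k) : ℕ :=
  ((C.edgesAt v).filter fun e => ¬ C.IsOutgoing v e ∧ Even (weight (C.dirAt v e))).card

/-- The number of real markings at `v`. -/
noncomputable def realMarks (C : OrientedCurve r s Δ F) (v : Fin C.k) : ℕ :=
  Nat.card {i // C.realAt i = v}

/-- The number of complex markings at `v`. -/
noncomputable def cplxMarks (C : OrientedCurve r s Δ F) (v : Fin C.k) : ℕ :=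
  Nat.card {i // C.cplxAt i = v}

/-- The Mikhalkin multiplicity of a vertex with three adjacent unmarked edges: the absolute value
of the determinant of the direction vectors of two of these edges. By the balancing condition all
pairs of different edges give the same value, and a pair of equal edges gives `0`, so it is the
maximum over all pairs. -/
noncomputable def mikh (C : OrientedCurve r s Δ F) (v : Fin C.k) : ℕ :=
  (C.edgesAt v ×ˢ C.edgesAt v).sup fun p => absDet (C.dirAt v p.1) (C.dirAt v p.2)

/-- The vertex `v` has `a` real and `b` complex markings, `oo` outgoing odd, `oe` outgoing even,
`io` incoming odd and `ie` incoming even unmarked edges. -/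
def HasVertexType (C : OrientedCurve r s Δ F) (v : Fin C.k) (a b oo oe io ie : ℕ) : Prop :=
  C.realMarks v = a ∧ C.cplxMarks v = b ∧
    C.outOdd v = oo ∧ C.outEven v = oe ∧ C.inOdd v = io ∧ C.inEven v = ie

/-- Type (1): a real marking and two outgoing odd edges. -/
def IsType1 (C : OrientedCurve r s Δ F) (v : Fin C.k) : Prop := C.HasVertexType v 1 0 2 0 0 0

/-- Type (2): unmarked, two incoming odd edges and one outgoing odd edge. -/
def IsType2 (C : OrientedCurve r s Δ F) (v : Fin C.k) : Prop := C.HasVertexType v 0 0 1 0 2 0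

/-- Type (3): unmarked, one incoming even, one incoming odd and one outgoing odd edge. -/
def IsType3 (C : OrientedCurve r s Δ F) (v : Fin C.k) : Prop := C.HasVertexType v 0 0 1 0 1 1

/-- Type (4): unmarked, two incoming even edges and one outgoing even edge. -/
def IsType4 (C : OrientedCurve r s Δ F) (v : Fin C.k) : Prop := C.HasVertexType v 0 0 0 1 0 2

/-- Type (5): a complex marking and three outgoing odd edges. -/
def IsType5 (C : OrientedCurve r s Δ F) (v : Fin C.k) : Prop := C.HasVertexType v 0 1 3 0 0 0

/-- Type (6): a complex marking, two outgoing odd edges and one outgoing even edge. -/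
def IsType6 (C : OrientedCurve r s Δ F) (v : Fin C.k) : Prop := C.HasVertexType v 0 1 2 1 0 0

/-- Type (I): a real marking and two outgoing edges of any parity. -/
def IsTypeI (C : OrientedCurve r s Δ F) (v : Fin C.k) : Prop :=
  C.realMarks v = 1 ∧ C.cplxMarks v = 0 ∧
    C.outOdd v + C.outEven v = 2 ∧ C.inOdd v + C.inEven v = 0

/-- Type (II): unmarked, two incoming edges and one outgoing edge of any parity. -/
def IsTypeII (C : OrientedCurve r s Δ F) (v : Fin C.k) : Prop :=
  C.realMarks v = 0 ∧ C.cplxMarks v = 0 ∧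
    C.outOdd v + C.outEven v = 1 ∧ C.inOdd v + C.inEven v = 2

/-- Type (III): a complex marking and three outgoing edges of any parity. -/
def IsTypeIII (C : OrientedCurve r s Δ F) (v : Fin C.k) : Prop :=
  C.realMarks v = 0 ∧ C.cplxMarks v = 1 ∧
    C.outOdd v + C.outEven v = 3 ∧ C.inOdd v + C.inEven v = 0

/-- Broccoli curves: all vertices are of the types (1) to (6). -/
def IsBroccoli (C : OrientedCurve r s Δ F) : Prop :=
  ∀ v, C.IsType1 v ∨ C.IsType2 v ∨ C.IsType3 v ∨ C.IsType4 v ∨ C.IsType5 v ∨ C.IsType6 v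

/-- Oriented refined broccoli curves: all vertices are of the types (I), (II), (III). -/
def IsRefinedBroccoli (C : OrientedCurve r s Δ F) : Prop :=
  ∀ v, C.IsTypeI v ∨ C.IsTypeII v ∨ C.IsTypeIII v

/-! ### Multiplicities -/

open scoped Classical in
/-- The multiplicity `m_V` of a vertex of type (1) to (6) with Mikhalkin multiplicity `a`:
`1` for (1), `i^(a-1)` for (2) and (6), `a i^(a-1)` for (3), (4) and (5). Other vertices do not
occur on broccoli curves; they get the value `0` here. -/
noncomputable def vertexMult (C : OrientedCurve r s Δ F) (v : Fin C.k) : ℂ :=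
  if C.IsType1 v then 1
  else if C.IsType2 v ∨ C.IsType6 v then Complex.I ^ ((C.mikh v : ℤ) - 1)
  else if C.IsType3 v ∨ C.IsType4 v ∨ C.IsType5 v then
    (C.mikh v : ℂ) * Complex.I ^ ((C.mikh v : ℤ) - 1)
  else 0

/-- The multiplicity `m_C` of a broccoli curve. -/
noncomputable def mult (C : OrientedCurve r s Δ F) : ℂ :=
  (∏ i, Complex.I ^ ((weight (Δ i) : ℤ) - 1)) * ∏ v, C.vertexMult v

open RatFunc in
open scoped Classical in
/-- The refined multiplicity `m_V(y)` of a vertex of type (I), (II), (III), as a rational function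
in the variable `X = y^(1/2)`. Other vertices do not occur on refined broccoli curves; they get
the value `0` here. -/
noncomputable def refinedVertexMult (C : OrientedCurve r s Δ F) (v : Fin C.k) : RatFunc ℚ :=
  if C.IsTypeI v then 1
  else if C.IsTypeII v then (X ^ C.mikh v - (X ^ C.mikh v)⁻¹) / (X - X⁻¹)
  else if C.IsTypeIII v then (X ^ C.mikh v + (X ^ C.mikh v)⁻¹) / (X + X⁻¹)
  else 0

end OrientedCurve

open RatFunc in
/-- The factor `m_{y_i}(y)` of a fixed end of weight `w`, with `X = y^(1/2)`. -/
noncomputable def fixedEndMult (w : ℕ) : RatFunc ℚ :=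
  (X ^ w + (-1) ^ w * (X ^ w)⁻¹) / (X + (-1) ^ w * X⁻¹)

open RatFunc in
/-- The factor `m_{y_i}(y)` of a non-fixed end of weight `w`, with `X = y^(1/2)`. -/
noncomputable def freeEndMult (w : ℕ) : RatFunc ℚ :=
  (X ^ w - (-1) ^ w * (X ^ w)⁻¹) / ((w : RatFunc ℚ) * (X - (-1) ^ w * X⁻¹))

namespace OrientedCurve

variable {r s n : ℕ} {Δ : Fin n → ℤ × ℤ} {F : Finset (Fin n)}

/-- The refined multiplicity `m_C(y)`, as a rational function in `X = y^(1/2)`. -/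
noncomputable def refinedMult (C : OrientedCurve r s Δ F) : RatFunc ℚ :=
  (∏ i, if i ∈ F then fixedEndMult (weight (Δ i)) else freeEndMult (weight (Δ i))) *
    ∏ v, C.refinedVertexMult v

/-! ### Multiplicities only depend on the isomorphism class -/

theorem IsTypeIso.map_edgesAt {C D : OrientedCurve r s Δ F} {σ : Fin C.k ≃ Fin D.k}
    (h : IsTypeIso C D σ) (v : Fin C.k) :
    D.edgesAt (σ v) = (C.edgesAt v).map (σ.sumCongr (Equiv.refl _)).toEmbedding := by
  ext e
  rw [Finset.mem_map_equiv]
  rcases e with u | i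
  · have := h.adj v (σ.symm u)
    simp only [Equiv.apply_symm_apply] at this
    simp [edgesAt, this]
  · simp [edgesAt, h.endAt]

theorem IsTypeIso.dirAt_eq {C D : OrientedCurve r s Δ F} {σ : Fin C.k ≃ Fin D.k}
    (h : IsTypeIso C D σ) (v : Fin C.k) {e : Fin C.k ⊕ Fin n} (he : e ∈ C.edgesAt v) :
    D.dirAt (σ v) (σ.sumCongr (Equiv.refl _) e) = C.dirAt v e := by
  rcases e with u | i
  · simp only [edgesAt, Finset.mem_filter, Sum.elim_inl] at he
    simpa [dirAt] using h.dir v u he.2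
  · simp [dirAt]

theorem IsTypeIso.isOutgoing_iff {C D : OrientedCurve r s Δ F} {σ : Fin C.k ≃ Fin D.k}
    (h : IsTypeIso C D σ) (v : Fin C.k) {e : Fin C.k ⊕ Fin n} (he : e ∈ C.edgesAt v) :
    D.IsOutgoing (σ v) (σ.sumCongr (Equiv.refl _) e) ↔ C.IsOutgoing v e := by
  rcases e with u | i
  · simp only [edgesAt, Finset.mem_filter, Sum.elim_inl] at he
    simpa [IsOutgoing] using h.orient v u he.2
  · simp [IsOutgoing]

open scoped Classical in
theorem IsTypeIso.card_filter {C D : OrientedCurve r s Δ F} {σ : Fin C.k ≃ Fin D.k}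
    (h : IsTypeIso C D σ) (v : Fin C.k) (p : Prop → ℤ × ℤ → Prop) :
    ((D.edgesAt (σ v)).filter fun e => p (D.IsOutgoing (σ v) e) (D.dirAt (σ v) e)).card =
      ((C.edgesAt v).filter fun e => p (C.IsOutgoing v e) (C.dirAt v e)).card := by
  rw [h.map_edgesAt, Finset.filter_map, Finset.card_map]
  congr 1
  refine Finset.filter_congr fun e he => ?_
  simp only [Function.comp, Equiv.coe_toEmbedding]
  rw [h.dirAt_eq v he, propext (h.isOutgoing_iff v he)]

theorem IsTypeIso.mikh_eq {C D : OrientedCurve r s Δ F} {σ : Fin C.k ≃ Fin D.k}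
    (h : IsTypeIso C D σ) (v : Fin C.k) : D.mikh (σ v) = C.mikh v := by
  unfold mikh
  rw [h.map_edgesAt, ← Finset.prodMap_map_product, Finset.sup_map]
  refine Finset.sup_congr rfl fun e he => ?_
  rw [Finset.mem_product] at he
  have h1 := h.dirAt_eq v he.1
  have h2 := h.dirAt_eq v he.2
  simp only [Function.comp, Function.Embedding.prodMap, Function.Embedding.coeFn_mk,
    Prod.map]
  rw [h1, h2]

theorem IsTypeIso.hasVertexType {C D : OrientedCurve r s Δ F} {σ : Fin C.k ≃ Fin D.k}
    (h : IsTypeIso C D σ) (v : Fin C.k) :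
    D.realMarks (σ v) = C.realMarks v ∧ D.cplxMarks (σ v) = C.cplxMarks v ∧
      D.outOdd (σ v) = C.outOdd v ∧ D.outEven (σ v) = C.outEven v ∧
      D.inOdd (σ v) = C.inOdd v ∧ D.inEven (σ v) = C.inEven v := by
  refine ⟨?_, ?_, by unfold outOdd; convert h.card_filter v fun o d => o ∧ Odd (weight d),
    by unfold outEven; convert h.card_filter v fun o d => o ∧ Even (weight d),
    by unfold inOdd; convert h.card_filter v fun o d => ¬ o ∧ Odd (weight d),
    by unfold inEven; convert h.card_filter v fun o d => ¬ o ∧ Even (weight d)⟩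
  · simp [realMarks, h.realAt]
  · simp [cplxMarks, h.cplxAt]

theorem mult_eq_of_isom {C D : OrientedCurve r s Δ F} (h : Isom C D) : C.mult = D.mult := by
  obtain ⟨σ, h, -⟩ := h
  unfold mult
  congr 1
  refine Fintype.prod_equiv σ _ _ fun v => ?_
  obtain ⟨h1, h2, h3, h4, h5, h6⟩ := h.hasVertexType v
  have e (a b oo oe io ie : ℕ) : D.HasVertexType (σ v) a b oo oe io ie =
      C.HasVertexType v a b oo oe io ie := by
    simp only [HasVertexType, h1, h2, h3, h4, h5, h6]
  unfold vertexMult IsType1 IsType2 IsType3 IsType4 IsType5 IsType6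
  simp_rw [h.mikh_eq v]
  rw [e, e, e, e, e, e]

theorem refinedMult_eq_of_isom {C D : OrientedCurve r s Δ F} (h : Isom C D) :
    C.refinedMult = D.refinedMult := by
  obtain ⟨σ, h, -⟩ := h
  unfold refinedMult
  congr 1
  refine Fintype.prod_equiv σ _ _ fun v => ?_
  obtain ⟨h1, h2, h3, h4, h5, h6⟩ := h.hasVertexType v
  have e1 : D.IsTypeI (σ v) = C.IsTypeI v := by
    simp only [IsTypeI, h1, h2, h3, h4, h5, h6]
  have e2 : D.IsTypeII (σ v) = C.IsTypeII v := by
    simp only [IsTypeII, h1, h2, h3, h4, h5, h6]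
  have e3 : D.IsTypeIII (σ v) = C.IsTypeIII v := by
    simp only [IsTypeIII, h1, h2, h3, h4, h5, h6]
  unfold refinedVertexMult
  rw [e1, e2, e3, h.mikh_eq v]

/-! ### Closures and general position -/

/-- The combinatorial type of `D` arises from that of `C` by contracting bounded edges: `f` maps
each vertex of `C` to the vertex of `D` into which it is merged. -/
structure IsContraction (C D : OrientedCurve r s Δ F) (f : Fin C.k → Fin D.k) : Prop where
  surjective : Function.Surjective f
  fibre_connected : ∀ w, (C.G.induce {u | f u = w}).Connected
  endAt : ∀ i, D.endAt i = f (C.endAt i)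
  realAt : ∀ i, D.realAt i = f (C.realAt i)
  cplxAt : ∀ i, D.cplxAt i = f (C.cplxAt i)
  adj : ∀ u v, C.G.Adj u v → f u ≠ f v → D.G.Adj (f u) (f v)
  dir : ∀ u v, C.G.Adj u v → f u ≠ f v → D.dir (f u) (f v) = C.dir u v
  orient : ∀ u v, C.G.Adj u v → f u ≠ f v → (D.orient (f u) (f v) ↔ C.orient u v)
  adj_exists : ∀ w w', D.G.Adj w w' → ∃ u v, C.G.Adj u v ∧ f u = w ∧ f v = w'

/-- The closure of a union `X` of cells in the moduli space of oriented curves: a curve lies in the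
closure of a cell if some (possibly empty) set of edge lengths of curves in that cell tends to
zero, i.e. if its combinatorial type is a contraction of the type of that cell. -/
def closure (X : Set (OrientedCurve r s Δ F)) : Set (OrientedCurve r s Δ F) :=
  {D | ∃ C ∈ X, ∃ f, IsContraction C D f}

/-- The cell of the curves in `M` that have the same combinatorial type as `C`. -/
def cell (M : Set (OrientedCurve r s Δ F)) (C : OrientedCurve r s Δ F) :
    Set (OrientedCurve r s Δ F) :=
  {D ∈ M | SameType C D}

/-- Conditions in general position for the evaluation map on `M`: they do not lie in the image of
any cell of `M` whose image has dimension smaller than `2(r+s)+|F|`. -/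
def InGeneralPosition (M : Set (OrientedCurve r s Δ F)) (P : Conditions r s Δ F) : Prop :=
  ∀ C ∈ M, Module.finrank ℝ (vectorSpan ℝ (ev '' cell M C)) < 2 * (r + s) + F.card →
    P ∉ ev '' cell M C

end OrientedCurve

open OrientedCurve

/-! ### Moduli space and invariants -/

/-- Isomorphism classes of connected oriented `(r,s)`-marked curves of degree `Δ` with set of
fixed ends `F`. -/
def Moduli (r s : ℕ) {n : ℕ} (Δ : Fin n → ℤ × ℤ) (F : Finset (Fin n)) : Type :=
  Quotient (OrientedCurve.setoid r s Δ F)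

variable {r s n : ℕ} {Δ : Fin n → ℤ × ℤ} {F : Finset (Fin n)}

/-- The multiplicity of an isomorphism class. -/
noncomputable def Moduli.mult : Moduli r s Δ F → ℂ :=
  Quotient.lift OrientedCurve.mult fun _ _ h => mult_eq_of_isom h

/-- The refined multiplicity of an isomorphism class. -/
noncomputable def Moduli.refinedMult : Moduli r s Δ F → RatFunc ℚ :=
  Quotient.lift OrientedCurve.refinedMult fun _ _ h => refinedMult_eq_of_isom h

/-- The closure of the broccoli curves. -/
def broccoliSpace (r s : ℕ) {n : ℕ} (Δ : Fin n → ℤ × ℤ) (F : Finset (Fin n)) :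
    Set (OrientedCurve r s Δ F) :=
  OrientedCurve.closure {C | C.IsBroccoli}

/-- The closure of the oriented refined broccoli curves. -/
def refinedBroccoliSpace (r s : ℕ) {n : ℕ} (Δ : Fin n → ℤ × ℤ) (F : Finset (Fin n)) :
    Set (OrientedCurve r s Δ F) :=
  OrientedCurve.closure {C | C.IsRefinedBroccoli}

/-- The isomorphism classes of broccoli curves through `P`. -/
def broccoliCurvesThrough (P : Conditions r s Δ F) : Set (Moduli r s Δ F) :=
  {q | ∃ C : OrientedCurve r s Δ F,
    C ∈ broccoliSpace r s Δ F ∧ C.IsBroccoli ∧ C.ev = P ∧ Quotient.mk _ C = q}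

/-- The isomorphism classes of oriented refined broccoli curves through `P`. -/
def refinedBroccoliCurvesThrough (P : Conditions r s Δ F) : Set (Moduli r s Δ F) :=
  {q | ∃ C : OrientedCurve r s Δ F,
    C ∈ refinedBroccoliSpace r s Δ F ∧ C.IsRefinedBroccoli ∧ C.ev = P ∧ Quotient.mk _ C = q}

/-- The broccoli invariant `N^B_{(r,s)}(Δ,F,P)`. -/
noncomputable def broccoliInvariant (P : Conditions r s Δ F) : ℂ :=
  (Nat.card (symGroup Δ F) : ℂ)⁻¹ * ∑ᶠ q ∈ broccoliCurvesThrough P, q.mult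

/-- The oriented refined broccoli invariant `N^{rB}_{(r,s)}(y,Δ,F,P)`, as a rational function in
`X = y^(1/2)`. -/
noncomputable def refinedBroccoliInvariant (P : Conditions r s Δ F) : RatFunc ℚ :=
  (Nat.card (symGroup Δ F) : RatFunc ℚ)⁻¹ *
    ∑ᶠ q ∈ refinedBroccoliCurvesThrough P, q.refinedMult

/-- The Laurent polynomial `L(y)` as a rational function in `X = y^(1/2)`, i.e. `L(X²)`. -/
noncomputable def inSqrtVariable (L : LaurentPolynomial ℚ) : RatFunc ℚ :=
  LaurentPolynomial.eval₂ (algebraMap ℚ (RatFunc ℚ))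
    (Units.mk0 (RatFunc.X ^ 2) (pow_ne_zero 2 RatFunc.X_ne_zero)) L

/-- The value of the Laurent polynomial `L(y)` at `y = -1`. -/
noncomputable def evalNegOne (L : LaurentPolynomial ℚ) : ℂ :=
  LaurentPolynomial.eval₂ (algebraMap ℚ ℂ) (-1) L

end Broccoli

namespace Broccoli

/-! The comparison is made curve by curve. Write `X` for `y^(1/2)`. A single local factor need be
neither a Laurent polynomial in `y` nor finite at `y = -1`, but it is always `(X + X⁻¹)^e` times a
Laurent polynomial `L` in `y = X²`. For an end, `e` is `1` if it is even and free, `-1` if it is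
even and fixed, and `0` if it is odd. For a vertex, `e = 2N - (outgoing even edges - incoming even
edges)`. Balancing modulo 2 limits the possible parities, and the case check in `vertexMult_eq`
shows `N = 0` exactly at the vertices of types (1) to (6). A bounded even edge is outgoing at one of
its vertices and incoming at the other, so it cancels in the sum of all exponents, and the ends
cancel against their own factors (`sum_outEven_sub_inEven`). Hence a curve has multiplicity `(X +
X⁻¹)^(2 ∑ N) = (y + 2 + y⁻¹)^(∑ N)` times a Laurent polynomial. At `y = -1` this vanishes unless the
curve is a broccoli curve. In that case each broccoli factor is `(2i)^e` times the value of the same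
`L` at `-1`, and the powers of `2i` cancel by the same count. The sums are finite because the tree
structure, the attachments and the orientations determine the directions by balancing, which leaves
finitely many types, and each type contributes at most one curve: a cell has dimension at most `k +
1 = n + r - 1 = 2(r+s) + |F|`, so general position makes evaluation injective on it. -/

theorem ite_eq_ite_of_iff {α : Type*} {p q : Prop} {_ : Decidable p} {_ : Decidable q} {x y : α}
    (h : p ↔ q) : ite p x y = ite q x y :=
  if_congr h rfl rfl

theorem finsum_mem_setOf_eq_sum_ite {α M : Type*} [Fintype α] [AddCommMonoid M] (p : α → Prop)
    [DecidablePred p] (f : α → M) : ∑ᶠ a ∈ {a | p a}, f a = ∑ a, if p a then f a else 0 := by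
  rw [← Finset.sum_filter, ← finsum_mem_coe_finset]
  simp

/-! ### Flows and lengths on trees -/

open scoped Classical in
/-- An antisymmetric flow on an acyclic graph whose divergence vanishes everywhere is zero. -/
theorem flow_eq_zero_of_isAcyclic {V : Type*} [Fintype V] {G : SimpleGraph V} (hG : G.IsAcyclic)
    {δ : V → V → ℤ × ℤ} (hanti : ∀ u v, δ v u = - δ u v) (hsupp : ∀ u v, ¬ G.Adj u v → δ u v = 0)
    (hdiv : ∀ v, ∑ u, δ v u = 0) (u v : V) : δ u v = 0 := by
  by_cases huv : G.Adj u v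
  swap
  · exact hsupp u v huv
  have hb : ¬ (G.deleteEdges {s(u, v)}).Reachable u v :=
    SimpleGraph.isBridge_iff.1 (SimpleGraph.isAcyclic_iff_forall_adj_isBridge.1 hG huv)
  -- Cut the graph at the bridge `uv` and add up the divergences over the side of `u`. Flows inside
  -- `A` cancel in pairs, and `uv` is the only edge that leaves `A`.
  set A : Finset V := Finset.univ.filter fun w => (G.deleteEdges {s(u, v)}).Reachable u w with hA
  have htot : ∑ w ∈ A, ∑ x, δ w x = 0 := Finset.sum_eq_zero fun w _ => hdiv w
  have hin : ∑ w ∈ A, ∑ x ∈ A, δ w x = 0 := by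
    have h1 : ∑ w ∈ A, ∑ x ∈ A, δ w x = - ∑ w ∈ A, ∑ x ∈ A, δ w x := by
      conv_lhs => rw [Finset.sum_comm]
      simp_rw [← Finset.sum_neg_distrib]
      exact Finset.sum_congr rfl fun w _ => Finset.sum_congr rfl fun x _ => hanti w x
    have h2 : ∀ z : ℤ × ℤ, z = -z → z = 0 := by
      rintro ⟨a, b⟩ h
      simp only [Prod.neg_mk, Prod.mk.injEq] at h
      ext <;> simp <;> omega
    exact h2 _ h1
  have hout : ∑ w ∈ A, ∑ x ∈ Aᶜ, δ w x = δ u v := by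
    have hcut : ∀ w ∈ A, ∀ x ∈ Aᶜ, ¬ (w = u ∧ x = v) → δ w x = 0 := by
      intro w hw x hx hne
      refine hsupp w x fun hwx => ?_
      simp only [hA, Finset.mem_compl, Finset.mem_filter, Finset.mem_univ, true_and] at hw hx
      by_cases he : s(w, x) = s(u, v)
      · rw [Sym2.eq_iff] at he
        rcases he with he | ⟨rfl, rfl⟩
        · exact hne he
        · exact hb hw
      · exact hx (hw.trans (SimpleGraph.Adj.reachable (by
          rw [SimpleGraph.deleteEdges_adj]; exact ⟨hwx, by simpa using he⟩)))
    rw [Finset.sum_eq_single u, Finset.sum_eq_single v]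
    · exact fun x hx hne => hcut u (by simp [hA]) x hx (by tauto)
    · intro h; simp [hA] at h; exact absurd h hb
    · exact fun w hw hne => Finset.sum_eq_zero fun x hx => hcut w hw x hx (by tauto)
    · intro h; simp [hA] at h
  have : ∑ w ∈ A, ∑ x, δ w x = ∑ w ∈ A, ∑ x ∈ A, δ w x + ∑ w ∈ A, ∑ x ∈ Aᶜ, δ w x := by
    rw [← Finset.sum_add_distrib]
    exact Finset.sum_congr rfl fun w _ => (Finset.sum_add_sum_compl A _).symm
  rw [htot, hin, hout, zero_add] at this
  exact this.symm

namespace OrientedCurve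

variable {r s n : ℕ} {Δ : Fin n → ℤ × ℤ} {F : Finset (Fin n)}

/-! ### Refined broccoli curves and closures -/

theorem IsBroccoli.isRefinedBroccoli {C : OrientedCurve r s Δ F} (h : C.IsBroccoli) :
    C.IsRefinedBroccoli := by
  intro v
  have := h v
  simp only [IsType1, IsType2, IsType3, IsType4, IsType5, IsType6, HasVertexType] at this
  simp only [IsTypeI, IsTypeII, IsTypeIII]
  omega

theorem IsContraction.refl (C : OrientedCurve r s Δ F) : IsContraction C C id where
  surjective := Function.surjective_id
  fibre_connected w := by
    have : Subsingleton {u | id u = w} := ⟨fun a b => Subtype.ext (a.2.trans b.2.symm)⟩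
    have : Nonempty {u | id u = w} := ⟨⟨w, rfl⟩⟩
    exact ⟨SimpleGraph.Preconnected.of_subsingleton⟩
  endAt _ := rfl
  realAt _ := rfl
  cplxAt _ := rfl
  adj _ _ h _ := h
  dir _ _ _ _ := rfl
  orient _ _ _ _ := Iff.rfl
  adj_exists w w' h := ⟨w, w', h, rfl, rfl⟩

theorem subset_closure (M : Set (OrientedCurve r s Δ F)) : M ⊆ closure M :=
  fun C hC => ⟨C, hC, id, IsContraction.refl C⟩

theorem closure_mono {M N : Set (OrientedCurve r s Δ F)} (h : M ⊆ N) : closure M ⊆ closure N :=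
  fun _ ⟨C, hC, hD⟩ => ⟨C, h hC, hD⟩

theorem IsContraction.trans_typeIso {C D E : OrientedCurve r s Δ F} {f : Fin C.k → Fin D.k}
    (hf : IsContraction C D f) {σ : Fin D.k ≃ Fin E.k} (hσ : IsTypeIso D E σ) :
    IsContraction C E (σ ∘ f) where
  surjective := σ.surjective.comp hf.surjective
  fibre_connected w := by
    have : {u | (σ ∘ f) u = w} = {u | f u = σ.symm w} := by
      ext u; simp [Equiv.eq_symm_apply]
    rw [this]
    exact hf.fibre_connected _
  endAt i := by simp [hσ.endAt, hf.endAt]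
  realAt i := by simp [hσ.realAt, hf.realAt]
  cplxAt i := by simp [hσ.cplxAt, hf.cplxAt]
  adj u v h hne := (hσ.adj _ _).2 (hf.adj u v h fun e => hne (congrArg σ e))
  dir u v h hne := by
    have hne' : f u ≠ f v := fun e => hne (congrArg σ e)
    rw [← hf.dir u v h hne']
    exact hσ.dir _ _ (hf.adj u v h hne')
  orient u v h hne := by
    have hne' : f u ≠ f v := fun e => hne (congrArg σ e)
    rw [← hf.orient u v h hne']
    exact hσ.orient _ _ (hf.adj u v h hne')
  adj_exists w w' h := by
    obtain ⟨u, v, huv, h1, h2⟩ := hf.adj_exists (σ.symm w) (σ.symm w')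
      ((hσ.adj _ _).1 (by simpa using h))
    exact ⟨u, v, huv, by simp [h1], by simp [h2]⟩

theorem SameType.mem_closure {M : Set (OrientedCurve r s Δ F)} {C D : OrientedCurve r s Δ F}
    (h : SameType C D) (hC : C ∈ closure M) : D ∈ closure M := by
  obtain ⟨E, hE, f, hf⟩ := hC
  obtain ⟨σ, hσ⟩ := h
  exact ⟨E, hE, σ ∘ f, hf.trans_typeIso hσ⟩

/-- A closure is a union of full combinatorial types, so its cells do not depend on `M`. This lets
general position pass between different closures. -/
theorem cell_closure {M : Set (OrientedCurve r s Δ F)} {C : OrientedCurve r s Δ F}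
    (hC : C ∈ closure M) : cell (closure M) C = {D | SameType C D} := by
  ext D
  exact ⟨fun h => h.2, fun h => ⟨h.mem_closure hC, h⟩⟩

theorem InGeneralPosition.anti {M N : Set (OrientedCurve r s Δ F)} (h : M ⊆ N)
    {P : Conditions r s Δ F} (hP : InGeneralPosition (closure N) P) :
    InGeneralPosition (closure M) P := by
  intro C hC
  have := hP C (closure_mono h hC)
  rwa [cell_closure (closure_mono h hC), ← cell_closure hC] at this

/-! ### Counting vertices -/

open scoped Classical in
theorem card_edgesAt (C : OrientedCurve r s Δ F) (v : Fin C.k) :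
    (C.edgesAt v).card = C.outOdd v + C.outEven v + C.inOdd v + C.inEven v := by
  unfold outOdd outEven inOdd inEven
  have h1 := Finset.card_filter_add_card_filter_not (s := C.edgesAt v) (fun e => C.IsOutgoing v e)
  have h2 := Finset.card_filter_add_card_filter_not
    (s := (C.edgesAt v).filter fun e => C.IsOutgoing v e) (fun e => Odd (weight (C.dirAt v e)))
  have h3 := Finset.card_filter_add_card_filter_not
    (s := (C.edgesAt v).filter fun e => ¬ C.IsOutgoing v e) (fun e => Odd (weight (C.dirAt v e)))
  simp only [Finset.filter_filter, Nat.not_odd_iff_even] at h2 h3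
  omega

open scoped Classical in
theorem card_edgesAt_eq_degree_add (C : OrientedCurve r s Δ F) (v : Fin C.k) :
    (C.edgesAt v).card = C.G.degree v + (Finset.univ.filter fun i => C.endAt i = v).card := by
  unfold edgesAt
  rw [← SimpleGraph.card_neighborFinset_eq_degree, SimpleGraph.neighborFinset_eq_filter]
  simp only [Finset.card_filter, Fintype.sum_sum_type, Sum.elim_inl, Sum.elim_inr]
  exact congrArg₂ (· + ·) (Finset.sum_congr rfl fun _ _ => ite_eq_ite_of_iff Iff.rfl)
    (Finset.sum_congr rfl fun _ _ => ite_eq_ite_of_iff Iff.rfl)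

open scoped Classical in
-- At each vertex the unmarked edges and real markings number three in total; complex markings are
-- not counted. Since a tree has `k - 1` bounded edges, summing gives `3k = 2(k - 1) + n + r`.
theorem IsRefinedBroccoli.k_add_two {C : OrientedCurve r s Δ F} (h : C.IsRefinedBroccoli) :
    C.k + 2 = n + r := by
  have hv : ∀ v, (C.edgesAt v).card + (Finset.univ.filter fun i => C.realAt i = v).card = 3 := by
    intro v
    have h1 := h v
    have h2 : (Finset.univ.filter fun i => C.realAt i = v).card = C.realMarks v := by
      simp [realMarks, Fintype.card_subtype]
    rw [h2, card_edgesAt]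
    simp only [IsTypeI, IsTypeII, IsTypeIII] at h1
    omega
  have hsum : ∑ v, ((C.edgesAt v).card + (Finset.univ.filter fun i => C.realAt i = v).card)
      = 3 * C.k := by
    rw [Finset.sum_congr rfl fun v _ => hv v]
    simp [mul_comm]
  simp only [card_edgesAt_eq_degree_add, Finset.sum_add_distrib,
    SimpleGraph.sum_degrees_eq_twice_card_edges] at hsum
  have h1 := Finset.card_eq_sum_card_fiberwise (f := C.endAt) (s := Finset.univ)
    (t := Finset.univ) (fun _ _ => Finset.mem_univ _)
  have h2 := Finset.card_eq_sum_card_fiberwise (f := C.realAt) (s := Finset.univ)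
    (t := Finset.univ) (fun _ _ => Finset.mem_univ _)
  have h3 := C.isTree.card_edgeFinset
  simp only [Finset.card_univ, Fintype.card_fin] at h1 h2 h3
  omega

/-! ### Deformations of a curve inside its cell -/

/-- The linear deformations of a curve of the type of `C`: displacements of the vertices and
changes of the edge lengths. -/
def deformations (C : OrientedCurve r s Δ F) :
    Submodule ℝ ((Fin C.k → ℝ × ℝ) × (Fin C.k → Fin C.k → ℝ)) where
  carrier := {x | (∀ u v, C.G.Adj u v → x.1 v - x.1 u = x.2 u v • toReal (C.dir u v)) ∧
    (∀ u v, C.G.Adj u v → x.2 v u = x.2 u v) ∧ ∀ u v, ¬ C.G.Adj u v → x.2 u v = 0}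
  add_mem' := by
    rintro x y ⟨h1, h2, h3⟩ ⟨g1, g2, g3⟩
    refine ⟨fun u v h => ?_, fun u v h => ?_, fun u v h => ?_⟩
    · simp only [Prod.fst_add, Prod.snd_add, Pi.add_apply, add_smul, ← h1 u v h, ← g1 u v h]
      abel
    · simp [h2 u v h, g2 u v h]
    · simp [h3 u v h, g3 u v h]
  zero_mem' := ⟨fun u v _ => by simp, fun u v _ => by simp, fun u v _ => by simp⟩
  smul_mem' := by
    rintro c x ⟨h1, h2, h3⟩
    refine ⟨fun u v h => ?_, fun u v h => ?_, fun u v h => ?_⟩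
    · simp only [Prod.smul_fst, Prod.smul_snd, Pi.smul_apply, smul_assoc, ← h1 u v h, smul_sub]
    · simp [h2 u v h]
    · simp [h3 u v h]

/-- The linear part of the evaluation map on the cell of `C`. -/
def evLinear (C : OrientedCurve r s Δ F) : C.deformations →ₗ[ℝ] Conditions r s Δ F where
  toFun x := (fun j => x.1.1 (C.realAt j), fun j => x.1.1 (C.cplxAt j),
    fun i => Submodule.Quotient.mk (x.1.1 (C.endAt i)))
  map_add' _ _ := rfl
  map_smul' _ _ := rfl

/-- A deformation is determined by the displacement of one vertex (two parameters) and the length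
changes of the `k - 1` bounded edges. -/
theorem finrank_deformations_le (C : OrientedCurve r s Δ F) :
    Module.finrank ℝ C.deformations ≤ C.k + 1 := by
  classical
  obtain ⟨v₀⟩ := C.isTree.1.nonempty
  let φ : C.deformations →ₗ[ℝ] (ℝ × ℝ) × (C.G.edgeSet → ℝ) :=
    { toFun := fun x => (x.1.1 v₀, fun e => x.1.2 (Quot.out e.1).1 (Quot.out e.1).2)
      map_add' := fun _ _ => rfl
      map_smul' := fun _ _ => rfl }
  have hφ : Function.Injective φ := by
    rw [← LinearMap.ker_eq_bot, LinearMap.ker_eq_bot']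
    rintro ⟨⟨p, l⟩, h1, h2, h3⟩ hx
    simp only [φ, LinearMap.coe_mk, AddHom.coe_mk, Prod.mk_eq_zero] at hx
    obtain ⟨hp, hl⟩ := hx
    simp only at h1 h2 h3
    have hl0 : ∀ u v, l u v = 0 := by
      intro u v
      by_cases huv : C.G.Adj u v
      · have he := congrFun hl ⟨s(u, v), huv⟩
        simp only [Pi.zero_apply] at he
        -- `Quot.out` may list the two endpoints in either order; symmetry of the length change
        -- covers the reversed one.
        have hout : s((Quot.out s(u, v)).1, (Quot.out s(u, v)).2) = s(u, v) :=
          Quot.out_eq s(u, v)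
        rw [Sym2.eq_iff] at hout
        rcases hout with ⟨e1, e2⟩ | ⟨e1, e2⟩
        · rwa [e1, e2] at he
        · rw [e1, e2] at he
          rwa [← h2 u v huv]
      · exact h3 u v huv
    have hp0 : ∀ u, p u = 0 := by
      intro u
      obtain ⟨w⟩ := C.isTree.1.preconnected u v₀
      induction w with
      | nil => exact hp
      | cons hadj _ ih =>
        have := h1 _ _ hadj
        rw [ih hp, hl0] at this
        simpa using this
    have : (p, l) = 0 := Prod.ext (funext hp0) (funext fun u => funext fun v => hl0 u v)
    exact Subtype.ext this
  have hle := LinearMap.finrank_le_finrank_of_injective hφ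
  have hc := C.isTree.card_edgeFinset
  rw [Module.finrank_prod, Module.finrank_prod, Module.finrank_self, Module.finrank_fintype_fun_eq_card,
    ← SimpleGraph.edgeFinset_card] at hle
  rw [Fintype.card_fin] at hc
  omega

open scoped Classical in
/-- The deformation leading from `C` to a curve `D` of the same type. -/
noncomputable def deformationTo {C D : OrientedCurve r s Δ F} {σ : Fin C.k ≃ Fin D.k}
    (h : IsTypeIso C D σ) : C.deformations :=
  ⟨(fun u => D.pos (σ u) - C.pos u,
    fun u v => if C.G.Adj u v then D.len (σ u) (σ v) - C.len u v else 0), by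
    refine ⟨fun u v huv => ?_, fun u v huv => ?_, fun u v huv => ?_⟩
    · have h1 := D.affine _ _ ((h.adj u v).2 huv)
      rw [h.dir u v huv] at h1
      simp only [huv, if_true, sub_smul, ← C.affine u v huv, ← h1]
      abel
    · simp [huv, huv.symm, C.len_symm u v huv, D.len_symm _ _ ((h.adj u v).2 huv)]
    · simp [huv]⟩

theorem evLinear_deformationTo {C D : OrientedCurve r s Δ F} {σ : Fin C.k ≃ Fin D.k}
    (h : IsTypeIso C D σ) : C.evLinear (deformationTo h) = D.ev - C.ev := by
  refine Prod.ext ?_ (Prod.ext ?_ ?_) <;> funext i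
  · simp only [ev, h.realAt]; rfl
  · simp only [ev, h.cplxAt]; rfl
  · simp only [ev, h.endAt]; rfl

/-- Differences of evaluations inside the cell lie in the range of `evLinear`, so general position
forces its rank to be at least `2(r+s) + |F|`. Its domain has dimension at most `k + 1`, which is
that same number, so rank-nullity leaves no kernel. -/
theorem evLinear_injective {N : Set (OrientedCurve r s Δ F)} {C : OrientedCurve r s Δ F}
    (hC : C ∈ closure N) (hk : C.k + 1 = 2 * (r + s) + F.card)
    (hP : InGeneralPosition (closure N) C.ev) : Function.Injective C.evLinear := by
  have hmem : C ∈ cell (closure N) C := ⟨hC, Equiv.refl _, IsTypeIso.refl C⟩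
  have hge : 2 * (r + s) + F.card ≤
      Module.finrank ℝ (vectorSpan ℝ (ev '' cell (closure N) C)) := by
    by_contra hlt
    exact hP C hC (not_le.1 hlt) ⟨C, hmem, rfl⟩
  have hsub : vectorSpan ℝ (ev '' cell (closure N) C) ≤ LinearMap.range C.evLinear := by
    rw [vectorSpan_eq_span_vsub_set_right ℝ (Set.mem_image_of_mem ev hmem), Submodule.span_le]
    rintro _ ⟨_, ⟨D, ⟨-, σ, hσ⟩, rfl⟩, rfl⟩
    exact ⟨deformationTo hσ, evLinear_deformationTo hσ⟩
  have h1 := Submodule.finrank_mono hsub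
  have h2 := C.finrank_deformations_le
  have h3 := (Nat.add_le_add_right (hge.trans h1) _).trans
    C.evLinear.finrank_range_add_finrank_ker.le
  rw [← LinearMap.ker_eq_bot, ← Submodule.finrank_eq_zero (R := ℝ)]
  omega

theorem isom_of_evLinear_injective {C D : OrientedCurve r s Δ F}
    (hC : Function.Injective C.evLinear) (h : SameType C D) (hev : C.ev = D.ev) : Isom C D := by
  obtain ⟨σ, hσ⟩ := h
  have h0 : deformationTo hσ = 0 := hC (by rw [evLinear_deformationTo, hev, sub_self, map_zero])
  have h1 := congrArg Subtype.val h0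
  refine ⟨σ, hσ, fun u v huv => ?_, fun u => ?_⟩
  · have := congrFun (congrFun (congrArg Prod.snd h1) u) v
    simpa [deformationTo, huv, sub_eq_zero] using this
  · have := congrFun (congrArg Prod.fst h1) u
    simpa [deformationTo, sub_eq_zero] using this

/-! ### Finiteness -/

/-- The discrete data of a curve with `k` vertices. -/
abbrev TypeData (r s n k : ℕ) : Type :=
  SimpleGraph (Fin k) × (Fin n → Fin k) × (Fin r → Fin k) × (Fin s → Fin k) ×
    (Fin k → Fin k → Prop)

/-- The discrete data of a curve, except for the direction vectors. -/
def typeData (C : OrientedCurve r s Δ F) : Σ k, TypeData r s n k :=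
  ⟨C.k, C.G, C.endAt, C.realAt, C.cplxAt, C.orient⟩

/-- The direction vectors need not be recorded, since balancing on a tree determines them from the
ends. This is what makes the number of types finite. -/
theorem sameType_of_typeData_eq {C D : OrientedCurve r s Δ F} (h : C.typeData = D.typeData) :
    SameType C D := by
  classical
  obtain ⟨k, G, hG, e, rl, c, st, len, lp, ls, dir, ds, pos, af, bal, o, ho⟩ := C
  obtain ⟨k', G', hG', e', rl', c', st', len', lp', ls', dir', ds', pos', af', bal', o', ho'⟩ := D
  simp only [typeData, Sigma.mk.injEq] at h
  obtain ⟨rfl, h⟩ := h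
  simp only [heq_eq_eq, Prod.mk.injEq] at h
  obtain ⟨rfl, rfl, rfl, rfl, rfl⟩ := h
  -- The ends contribute equally to both balancing conditions, so the difference of the two
  -- direction assignments is a flow without divergence.
  have hdir := flow_eq_zero_of_isAcyclic hG.isAcyclic
    (δ := fun u v => if G.Adj u v then dir' u v - dir u v else 0)
    (fun u v => by
      by_cases huv : G.Adj u v
      · simp only [huv, huv.symm, if_true, ds u v huv, ds' u v huv]; abel
      · have : ¬ G.Adj v u := fun h => huv h.symm
        simp [huv, this])
    (fun u v huv => by simp [huv])
    (fun v => by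
      have h1 := bal v
      have h2 := bal' v
      rw [finsum_mem_setOf_eq_sum_ite] at h1 h2
      have : (fun u => if G.Adj v u then dir' v u - dir v u else 0) =
          fun u => (if G.Adj v u then dir' v u else 0) - (if G.Adj v u then dir v u else 0) := by
        funext u; split_ifs <;> simp
      simp only [this, Finset.sum_sub_distrib]
      rw [sub_eq_zero]
      exact add_right_cancel (h2.trans h1.symm))
  refine ⟨Equiv.refl _, fun _ _ => Iff.rfl, fun _ => rfl, fun _ => rfl, fun _ => rfl,
    fun u v huv => ?_, fun _ _ _ => Iff.rfl⟩
  have := hdir u v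
  simp only at huv
  simp only [huv, if_true, sub_eq_zero] at this
  exact this

end OrientedCurve

open OrientedCurve

variable {r s n : ℕ} {Δ : Fin n → ℤ × ℤ} {F : Finset (Fin n)}

theorem finite_refinedBroccoliCurvesThrough (hF : r + 2 * s + F.card + 1 = n)
    {P : Conditions r s Δ F} (hP : InGeneralPosition (refinedBroccoliSpace r s Δ F) P) :
    (refinedBroccoliCurvesThrough P).Finite := by
  choose rep hrep using fun q : refinedBroccoliCurvesThrough P => q.2
  have hk : ∀ q, (rep q).k < n + r := fun q => by
    have := (hrep q).2.1.k_add_two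
    omega
  -- The vertex count is `n + r - 2`; bounding it by `n + r` puts the discrete data into a finite
  -- type.
  let code : refinedBroccoliCurvesThrough P → Σ k : Fin (n + r), TypeData r s n k :=
    fun q => ⟨⟨(rep q).k, hk q⟩, (rep q).typeData.2⟩
  refine Finite.of_injective code fun q q' h => Subtype.ext ?_
  have htype : (rep q).typeData = (rep q').typeData :=
    congrArg (fun x : Σ k : Fin (n + r), TypeData r s n k =>
      (⟨x.1, x.2⟩ : Σ k, TypeData r s n k)) h
  have hinj : Function.Injective (rep q).evLinear := by
    refine evLinear_injective (hrep q).1 ?_ ((hrep q).2.2.1 ▸ hP)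
    have := (hrep q).2.1.k_add_two
    omega
  rw [← (hrep q).2.2.2, ← (hrep q').2.2.2]
  exact Quotient.sound (isom_of_evLinear_injective hinj (sameType_of_typeData_eq htype)
    ((hrep q).2.2.1.trans (hrep q').2.2.1.symm))

theorem broccoliCurvesThrough_subset (P : Conditions r s Δ F) :
    broccoliCurvesThrough P ⊆ refinedBroccoliCurvesThrough P := by
  rintro q ⟨C, -, hC, hev, rfl⟩
  exact ⟨C, subset_closure _ hC.isRefinedBroccoli, hC.isRefinedBroccoli, hev, rfl⟩

/-! ### Parity of weights and determinants -/

theorem even_weight_iff (d : ℤ × ℤ) : Even (weight d) ↔ Even d.1 ∧ Even d.2 := by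
  rw [even_iff_two_dvd, even_iff_two_dvd, even_iff_two_dvd, weight, ← Int.natCast_dvd_natCast,
    Int.dvd_coe_gcd_iff]
  rfl

theorem weight_neg (d : ℤ × ℤ) : weight (-d) = weight d := by
  simp [weight]

theorem even_absDet_iff (d e : ℤ × ℤ) : Even (absDet d e) ↔ Even (d.1 * e.2 - d.2 * e.1) := by
  rw [absDet, Int.natAbs_even]

namespace OrientedCurve

variable {r s n : ℕ} {Δ : Fin n → ℤ × ℤ} {F : Finset (Fin n)}

theorem sum_dirAt (C : OrientedCurve r s Δ F) (v : Fin C.k) :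
    ∑ e ∈ C.edgesAt v, C.dirAt v e = 0 := by
  classical
  rw [← C.balanced v, edgesAt, Finset.sum_filter, Fintype.sum_sum_type,
    finsum_mem_setOf_eq_sum_ite, finsum_mem_setOf_eq_sum_ite]
  exact congrArg₂ (· + ·) (Finset.sum_congr rfl fun _ _ => ite_eq_ite_of_iff Iff.rfl)
    (Finset.sum_congr rfl fun _ _ => ite_eq_ite_of_iff Iff.rfl)

open scoped Classical in
/-- The number of odd edges at a vertex. -/
theorem outOdd_add_inOdd (C : OrientedCurve r s Δ F) (v : Fin C.k) :
    C.outOdd v + C.inOdd v = ((C.edgesAt v).filter fun e => Odd (weight (C.dirAt v e))).card := by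
  unfold outOdd inOdd
  have h := Finset.card_filter_add_card_filter_not
    (s := (C.edgesAt v).filter fun e => Odd (weight (C.dirAt v e))) (fun e => C.IsOutgoing v e)
  simp only [Finset.filter_filter] at h
  rw [← h]
  congr 2 <;> ext e <;> simp only [Finset.mem_filter] <;> tauto

/-- The two direction vectors are opposite, hence of equal weight. -/
theorem odd_edges_ne_one_of_card_two (C : OrientedCurve r s Δ F) (v : Fin C.k)
    (h : (C.edgesAt v).card = 2) : C.outOdd v + C.inOdd v ≠ 1 := by
  classical
  obtain ⟨x, y, hxy, he⟩ := Finset.card_eq_two.1 h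
  have hs := C.sum_dirAt v
  rw [he, Finset.sum_pair hxy] at hs
  rw [outOdd_add_inOdd, he]
  have hw : weight (C.dirAt v y) = weight (C.dirAt v x) := by
    rw [← weight_neg, ← eq_neg_of_add_eq_zero_left hs]
  by_cases ho : Odd (weight (C.dirAt v x)) <;>
    simp [Finset.filter_insert, Finset.filter_singleton, hw, ho, hxy]

theorem mikh_eq_absDet (C : OrientedCurve r s Δ F) (v : Fin C.k) {x y z : Fin C.k ⊕ Fin n}
    (he : C.edgesAt v = {x, y, z}) (hs : C.dirAt v x + C.dirAt v y + C.dirAt v z = 0) :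
    C.mikh v = absDet (C.dirAt v x) (C.dirAt v y) := by
  classical
  have hz : C.dirAt v z = -(C.dirAt v x + C.dirAt v y) := (neg_eq_of_add_eq_zero_right hs).symm
  unfold mikh
  rw [he]
  apply le_antisymm
  · refine Finset.sup_le fun p hp => ?_
    obtain ⟨p, q⟩ := p
    simp only [Finset.mem_product, Finset.mem_insert, Finset.mem_singleton] at hp
    -- Absolute values are compared through squares. Every pair of distinct edges gives the same
    -- square, and a repeated edge gives zero, where this nonnegativity is needed.
    have hsq := mul_self_nonneg ((C.dirAt v x).1 * (C.dirAt v y).2 -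
      (C.dirAt v x).2 * (C.dirAt v y).1)
    rw [absDet, absDet, Int.natAbs_le_iff_mul_self_le]
    rcases hp with ⟨rfl | rfl | rfl, rfl | rfl | rfl⟩ <;>
      simp only [hz, Prod.fst_neg, Prod.snd_neg, Prod.fst_add, Prod.snd_add] <;> linarith
  · exact Finset.le_sup (f := fun p : (Fin C.k ⊕ Fin n) × (Fin C.k ⊕ Fin n) =>
      absDet (C.dirAt v p.1) (C.dirAt v p.2)) (b := (x, y)) (by simp)

/-- An edge is odd iff its direction is nonzero modulo 2. Three vectors of `(ℤ/2)²` with sum zero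
cannot include exactly one nonzero vector, and two of them are independent iff all three are
nonzero. -/
theorem odd_edges_of_card_three (C : OrientedCurve r s Δ F) (v : Fin C.k)
    (h : (C.edgesAt v).card = 3) : C.outOdd v + C.inOdd v ≠ 1 ∧
      (Odd (C.mikh v) ↔ C.outOdd v + C.inOdd v = 3) := by
  classical
  obtain ⟨x, y, z, hxy, hxz, hyz, he⟩ := Finset.card_eq_three.1 h
  have hs := C.sum_dirAt v
  rw [he, Finset.sum_insert (by simp [hxy, hxz]), Finset.sum_pair hyz, ← add_assoc] at hs
  have hz : C.dirAt v z = -(C.dirAt v x + C.dirAt v y) := (neg_eq_of_add_eq_zero_right hs).symm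
  rw [C.mikh_eq_absDet v he hs, outOdd_add_inOdd, he]
  simp only [Finset.filter_insert, Finset.filter_singleton, ← Nat.not_even_iff_odd,
    even_weight_iff, even_absDet_iff, hz]
  generalize C.dirAt v x = a
  generalize C.dirAt v y = b
  by_cases h1 : Even a.1 <;> by_cases h2 : Even a.2 <;> by_cases h3 : Even b.1 <;>
    by_cases h4 : Even b.2 <;>
    simp [h1, h2, h3, h4, hxy, hxz, hyz, Int.even_add, Int.even_sub, Int.even_mul]

/-! ### Counting even edges -/

open scoped Classical in
/-- The contribution of the end `y_i` to the difference of the numbers of outgoing and incoming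
even edges. -/
noncomputable def evenEndSign (Δ : Fin n → ℤ × ℤ) (F : Finset (Fin n)) (i : Fin n) : ℤ :=
  if Even (weight (Δ i)) then (if i ∈ F then -1 else 1) else 0

/-- Each bounded even edge counts once as outgoing and once as incoming, so only the even ends
survive. This is the cancellation of exponents over the whole curve. -/
theorem sum_outEven_sub_inEven (C : OrientedCurve r s Δ F) :
    ∑ v, ((C.outEven v : ℤ) - C.inEven v) = ∑ i, evenEndSign Δ F i := by
  classical
  have hout : ∀ v, (C.outEven v : ℤ) =
      (∑ u, if C.G.Adj v u ∧ C.orient v u ∧ Even (weight (C.dir v u)) then 1 else 0) +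
        ∑ i, if C.endAt i = v ∧ i ∉ F ∧ Even (weight (Δ i)) then 1 else 0 := by
    intro v
    unfold outEven edgesAt
    rw [Finset.filter_filter, Finset.card_filter, Fintype.sum_sum_type]
    push_cast
    exact congrArg₂ (· + ·) (Finset.sum_congr rfl fun _ _ => ite_eq_ite_of_iff Iff.rfl)
      (Finset.sum_congr rfl fun _ _ => ite_eq_ite_of_iff Iff.rfl)
  have hin : ∀ v, (C.inEven v : ℤ) =
      (∑ u, if C.G.Adj v u ∧ ¬ C.orient v u ∧ Even (weight (C.dir v u)) then 1 else 0) +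
        ∑ i, if C.endAt i = v ∧ ¬ i ∉ F ∧ Even (weight (Δ i)) then 1 else 0 := by
    intro v
    unfold inEven edgesAt
    rw [Finset.filter_filter, Finset.card_filter, Fintype.sum_sum_type]
    push_cast
    exact congrArg₂ (· + ·) (Finset.sum_congr rfl fun _ _ => ite_eq_ite_of_iff Iff.rfl)
      (Finset.sum_congr rfl fun _ _ => ite_eq_ite_of_iff Iff.rfl)
  have hb : ∑ v, ∑ u, (if C.G.Adj v u ∧ C.orient v u ∧ Even (weight (C.dir v u)) then (1 : ℤ)
      else 0) =
      ∑ v, ∑ u, if C.G.Adj v u ∧ ¬ C.orient v u ∧ Even (weight (C.dir v u)) then (1 : ℤ)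
        else 0 := by
    rw [Finset.sum_comm]
    refine Finset.sum_congr rfl fun u _ => Finset.sum_congr rfl fun v _ => ?_
    by_cases huv : C.G.Adj u v
    · simp only [huv, huv.symm, true_and, C.orient_iff u v huv, C.dir_symm u v huv, weight_neg]
    · have : ¬ C.G.Adj v u := fun h => huv h.symm
      simp [huv, this]
  simp only [hout, hin, Finset.sum_sub_distrib, Finset.sum_add_distrib, hb]
  rw [add_sub_add_left_eq_sub, Finset.sum_comm, sub_eq_iff_eq_add,
    Finset.sum_comm (f := fun v i => if C.endAt i = v ∧ ¬ i ∉ F ∧ Even (weight (Δ i)) then (1 : ℤ)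
      else 0), ← Finset.sum_add_distrib]
  refine Finset.sum_congr rfl fun i _ => ?_
  by_cases h1 : i ∈ F <;> by_cases h2 : Even (weight (Δ i)) <;> simp [h1, h2, evenEndSign]

end OrientedCurve

/-! ### Laurent polynomials in `y` -/

open LaurentPolynomial in
theorem inSqrtVariable_T (k : ℤ) : inSqrtVariable (T k) = RatFunc.X ^ (2 * k) := by
  simp [inSqrtVariable, zpow_mul]

open LaurentPolynomial in
theorem evalNegOne_T (k : ℤ) : evalNegOne (T k) = (-1) ^ k := by
  simp [evalNegOne]

open LaurentPolynomial in
theorem inSqrtVariable_C (c : ℚ) : inSqrtVariable (C c) = algebraMap ℚ (RatFunc ℚ) c := by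
  simp [inSqrtVariable]

open LaurentPolynomial in
theorem evalNegOne_C (c : ℚ) : evalNegOne (C c) = c := by
  simp [evalNegOne]

theorem inSqrtVariable_one : inSqrtVariable 1 = 1 := map_one _
theorem inSqrtVariable_zero : inSqrtVariable 0 = 0 := map_zero _
theorem inSqrtVariable_add (L M : LaurentPolynomial ℚ) :
    inSqrtVariable (L + M) = inSqrtVariable L + inSqrtVariable M := map_add _ _ _
theorem inSqrtVariable_sub (L M : LaurentPolynomial ℚ) :
    inSqrtVariable (L - M) = inSqrtVariable L - inSqrtVariable M := map_sub _ _ _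
theorem inSqrtVariable_mul (L M : LaurentPolynomial ℚ) :
    inSqrtVariable (L * M) = inSqrtVariable L * inSqrtVariable M := map_mul _ _ _
theorem inSqrtVariable_pow (L : LaurentPolynomial ℚ) (k : ℕ) :
    inSqrtVariable (L ^ k) = inSqrtVariable L ^ k := map_pow _ _ _
theorem inSqrtVariable_sum {ι : Type*} (t : Finset ι) (f : ι → LaurentPolynomial ℚ) :
    inSqrtVariable (∑ i ∈ t, f i) = ∑ i ∈ t, inSqrtVariable (f i) := map_sum _ _ _
theorem inSqrtVariable_prod {ι : Type*} (t : Finset ι) (f : ι → LaurentPolynomial ℚ) :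
    inSqrtVariable (∏ i ∈ t, f i) = ∏ i ∈ t, inSqrtVariable (f i) := map_prod _ _ _
theorem evalNegOne_one : evalNegOne 1 = 1 := map_one _
theorem evalNegOne_zero : evalNegOne 0 = 0 := map_zero _
theorem evalNegOne_add (L M : LaurentPolynomial ℚ) :
    evalNegOne (L + M) = evalNegOne L + evalNegOne M := map_add _ _ _
theorem evalNegOne_sub (L M : LaurentPolynomial ℚ) :
    evalNegOne (L - M) = evalNegOne L - evalNegOne M := map_sub _ _ _
theorem evalNegOne_mul (L M : LaurentPolynomial ℚ) :
    evalNegOne (L * M) = evalNegOne L * evalNegOne M := map_mul _ _ _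
theorem evalNegOne_pow (L : LaurentPolynomial ℚ) (k : ℕ) :
    evalNegOne (L ^ k) = evalNegOne L ^ k := map_pow _ _ _
theorem evalNegOne_sum {ι : Type*} (t : Finset ι) (f : ι → LaurentPolynomial ℚ) :
    evalNegOne (∑ i ∈ t, f i) = ∑ i ∈ t, evalNegOne (f i) := map_sum _ _ _
theorem evalNegOne_prod {ι : Type*} (t : Finset ι) (f : ι → LaurentPolynomial ℚ) :
    evalNegOne (∏ i ∈ t, f i) = ∏ i ∈ t, evalNegOne (f i) := map_prod _ _ _

theorem ratFunc_X_sq_add_C_ne_zero (c : ℚ) : (RatFunc.X : RatFunc ℚ) ^ 2 + RatFunc.C c ≠ 0 := by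
  have h : (Polynomial.X ^ 2 + Polynomial.C c : Polynomial ℚ) ≠ 0 :=
    (Polynomial.monic_X_pow_add_C c two_ne_zero).ne_zero
  have := RatFunc.algebraMap_ne_zero h
  simpa using this

theorem X_add_inv_ne_zero : (RatFunc.X + RatFunc.X⁻¹ : RatFunc ℚ) ≠ 0 := by
  intro h
  have := ratFunc_X_sq_add_C_ne_zero 1
  have hX := RatFunc.X_ne_zero (K := ℚ)
  apply this
  field_simp at h
  simpa using h

theorem X_sub_inv_ne_zero : (RatFunc.X - RatFunc.X⁻¹ : RatFunc ℚ) ≠ 0 := by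
  intro h
  have := ratFunc_X_sq_add_C_ne_zero (-1)
  have hX := RatFunc.X_ne_zero (K := ℚ)
  apply this
  field_simp at h
  simpa [sub_eq_add_neg] using h

open LaurentPolynomial RatFunc in
-- The quotient is `y^m + y^(m-1) + ⋯ + y^(-m)`.
theorem exists_laurent_sub_odd (m : ℕ) : ∃ L : LaurentPolynomial ℚ,
    (X ^ (2 * m + 1) - (X ^ (2 * m + 1))⁻¹) / (X - X⁻¹) = inSqrtVariable L ∧
      evalNegOne L = (-1) ^ m := by
  have hX := RatFunc.X_ne_zero (K := ℚ)
  simp only [div_eq_iff X_sub_inv_ne_zero]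
  induction m with
  | zero => exact ⟨1, by simp [inSqrtVariable_one], by simp [evalNegOne_one]⟩
  | succ m ih =>
    obtain ⟨L, h1, h2⟩ := ih
    refine ⟨L + T ((m + 1 : ℕ) : ℤ) + T (-(m + 1 : ℕ) : ℤ), ?_, ?_⟩
    · rw [inSqrtVariable_add, inSqrtVariable_add, inSqrtVariable_T, inSqrtVariable_T,
        add_mul, add_mul, ← h1, mul_neg, zpow_neg]
      have : (X : RatFunc ℚ) ^ (2 * ((m + 1 : ℕ) : ℤ)) = X ^ (2 * (m + 1)) := by norm_cast
      rw [this]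
      field_simp
      ring
    · rw [evalNegOne_add, evalNegOne_add, evalNegOne_T, evalNegOne_T, h2, zpow_neg,
        zpow_natCast, ← inv_pow]
      norm_num
      ring

open LaurentPolynomial RatFunc in
-- The quotient is `y^m - y^(m-1) + ⋯ + y^(-m)`, with alternating signs; at `y = -1` all `2m + 1`
-- terms agree.
theorem exists_laurent_add_odd (m : ℕ) : ∃ L : LaurentPolynomial ℚ,
    (X ^ (2 * m + 1) + (X ^ (2 * m + 1))⁻¹) / (X + X⁻¹) = inSqrtVariable L ∧
      evalNegOne L = (2 * m + 1) * (-1) ^ m := by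
  have hX := RatFunc.X_ne_zero (K := ℚ)
  simp only [div_eq_iff X_add_inv_ne_zero]
  induction m with
  | zero => exact ⟨1, by simp [inSqrtVariable_one], by simp [evalNegOne_one]⟩
  | succ m ih =>
    obtain ⟨L, h1, h2⟩ := ih
    refine ⟨T ((m + 1 : ℕ) : ℤ) + T (-(m + 1 : ℕ) : ℤ) - L, ?_, ?_⟩
    · rw [inSqrtVariable_sub, inSqrtVariable_add, inSqrtVariable_T, inSqrtVariable_T,
        sub_mul, ← h1, mul_neg, zpow_neg]
      have : (X : RatFunc ℚ) ^ (2 * ((m + 1 : ℕ) : ℤ)) = X ^ (2 * (m + 1)) := by norm_cast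
      rw [this]
      field_simp
      ring
    · rw [evalNegOne_sub, evalNegOne_add, evalNegOne_T, evalNegOne_T, h2, zpow_neg,
        zpow_natCast, ← inv_pow]
      norm_num
      ring

open LaurentPolynomial RatFunc in
-- Here `L = y^(b-1) + y^(b-3) + ⋯ + y^(1-b)`, whose `b` terms agree at `y = -1`; the factor `X +
-- X⁻¹` carries the half-integer powers and the zero there.
theorem exists_laurent_sub_even (b : ℕ) : ∃ L : LaurentPolynomial ℚ,
    (X ^ (2 * b) - (X ^ (2 * b))⁻¹) / (X - X⁻¹) = (X + X⁻¹) * inSqrtVariable L ∧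
      evalNegOne L = -b * (-1) ^ b := by
  have hX := RatFunc.X_ne_zero (K := ℚ)
  simp only [div_eq_iff X_sub_inv_ne_zero]
  induction b with
  | zero => exact ⟨0, by simp [inSqrtVariable_zero], by simp [evalNegOne_zero]⟩
  | succ b ih =>
    obtain ⟨L, h1, h2⟩ := ih
    refine ⟨T 1 * L + T (-(b : ℕ) : ℤ), ?_, ?_⟩
    · have e : (X + X⁻¹) * inSqrtVariable (T 1 * L + T (-(b : ℕ) : ℤ)) * (X - X⁻¹) =
        X ^ 2 * ((X + X⁻¹) * inSqrtVariable L * (X - X⁻¹)) +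
          (X ^ (2 * b))⁻¹ * (X + X⁻¹) * (X - X⁻¹) := by
        have : (X : RatFunc ℚ) ^ (2 * (b : ℤ)) = X ^ (2 * b) := by norm_cast
        rw [inSqrtVariable_add, inSqrtVariable_mul, inSqrtVariable_T, inSqrtVariable_T,
          mul_neg, zpow_neg, this]
        norm_cast
        ring
      rw [e, ← h1]
      field_simp
      ring
    · rw [evalNegOne_add, evalNegOne_mul, evalNegOne_T, evalNegOne_T, h2, zpow_neg,
        zpow_natCast, ← inv_pow]
      norm_num
      ring

open LaurentPolynomial RatFunc in
theorem exists_laurent_add_even (b : ℕ) : ∃ L : LaurentPolynomial ℚ,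
    (X ^ (2 * b) + (X ^ (2 * b))⁻¹) / (X + X⁻¹) = (X + X⁻¹)⁻¹ * inSqrtVariable L ∧
      evalNegOne L = 2 * (-1) ^ b := by
  refine ⟨T (b : ℤ) + T (-(b : ℕ) : ℤ), ?_, ?_⟩
  · have : (X : RatFunc ℚ) ^ (2 * (b : ℤ)) = X ^ (2 * b) := by norm_cast
    rw [inSqrtVariable_add, inSqrtVariable_T, inSqrtVariable_T, mul_neg, zpow_neg, this,
      div_eq_inv_mul]
  · rw [evalNegOne_add, evalNegOne_T, evalNegOne_T, zpow_neg, zpow_natCast, ← inv_pow]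
    norm_num
    ring

theorem I_zpow_odd (m : ℕ) : Complex.I ^ (((2 * m + 1 : ℕ) : ℤ) - 1) = (-1) ^ m := by
  have : ((2 * m + 1 : ℕ) : ℤ) - 1 = ((2 * m : ℕ) : ℤ) := by push_cast; ring
  rw [this, zpow_natCast, pow_mul, Complex.I_sq]

theorem I_zpow_even (b : ℕ) : Complex.I ^ (((2 * b : ℕ) : ℤ) - 1) = -(-1) ^ b * Complex.I := by
  rw [zpow_sub₀ Complex.I_ne_zero, zpow_natCast, pow_mul, Complex.I_sq, zpow_one,
    div_eq_mul_inv, Complex.inv_I]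
  ring

theorem I_zpow_even_eq (b : ℕ) : Complex.I ^ (((2 * b : ℕ) : ℤ) - 1) =
    (2 * Complex.I)⁻¹ * (2 * (-1) ^ b) := by
  rw [I_zpow_even, mul_inv, Complex.inv_I]
  ring

/-! ### Local factors of the multiplicities -/

theorem two_mul_I_ne_zero : (2 * Complex.I : ℂ) ≠ 0 := mul_ne_zero two_ne_zero Complex.I_ne_zero

theorem natCast_ratFunc_eq (w : ℕ) : (w : RatFunc ℚ) = algebraMap ℚ (RatFunc ℚ) w := by simp

open RatFunc in
theorem fixedEndMult_eq (w : ℕ) : ∃ L : LaurentPolynomial ℚ,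
    fixedEndMult w = (X + X⁻¹) ^ (if Even w then -1 else 0 : ℤ) * inSqrtVariable L ∧
      Complex.I ^ ((w : ℤ) - 1) =
        (2 * Complex.I) ^ (if Even w then -1 else 0 : ℤ) * evalNegOne L := by
  rcases Nat.even_or_odd' w with ⟨b, rfl | rfl⟩
  · obtain ⟨L, h1, h2⟩ := exists_laurent_add_even b
    refine ⟨L, ?_, ?_⟩
    · simpa [fixedEndMult] using h1
    · rw [I_zpow_even_eq, h2]; simp
  · obtain ⟨L, h1, h2⟩ := exists_laurent_sub_odd b
    have ho : ¬ Even (2 * b + 1) := by simp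
    refine ⟨L, ?_, ?_⟩
    · simpa [fixedEndMult, ho, pow_succ (-1 : RatFunc ℚ), ← sub_eq_add_neg] using h1
    · rw [I_zpow_odd, h2]; simp [ho]

open RatFunc in
-- The denominator `w` cancels the factor that the value at `y = -1` produces: `b` for `w = 2b`,
-- with the remaining `2` absorbed by `2i`, and `w` itself for odd `w`.
theorem freeEndMult_eq {w : ℕ} (hw : w ≠ 0) : ∃ L : LaurentPolynomial ℚ,
    freeEndMult w = (X + X⁻¹) ^ (if Even w then 1 else 0 : ℤ) * inSqrtVariable L ∧
      Complex.I ^ ((w : ℤ) - 1) =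
        (2 * Complex.I) ^ (if Even w then 1 else 0 : ℤ) * evalNegOne L := by
  have key : freeEndMult w = inSqrtVariable (LaurentPolynomial.C (w : ℚ)⁻¹) *
      ((X ^ w - (-1) ^ w * (X ^ w)⁻¹) / (X - (-1) ^ w * X⁻¹)) := by
    rw [inSqrtVariable_C, map_inv₀, ← natCast_ratFunc_eq, freeEndMult, div_mul_eq_div_div_swap,
      div_eq_inv_mul _ (w : RatFunc ℚ)]
  rw [key]
  have hwC : (w : ℂ) ≠ 0 := Nat.cast_ne_zero.2 hw
  rcases Nat.even_or_odd' w with ⟨b, rfl | rfl⟩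
  · obtain ⟨L, h1, h2⟩ := exists_laurent_sub_even b
    refine ⟨LaurentPolynomial.C ((2 * b : ℕ) : ℚ)⁻¹ * L, ?_, ?_⟩
    · rw [inSqrtVariable_mul, mul_left_comm]
      congr 1
      simpa using h1
    · rw [I_zpow_even, evalNegOne_mul, evalNegOne_C, h2]
      have hb : (b : ℂ) ≠ 0 := by
        rintro h; apply hwC; push_cast; rw [h, mul_zero]
      simp
      field_simp
  · obtain ⟨L, h1, h2⟩ := exists_laurent_add_odd b
    have ho : ¬ Even (2 * b + 1) := by simp
    refine ⟨LaurentPolynomial.C ((2 * b + 1 : ℕ) : ℚ)⁻¹ * L, ?_, ?_⟩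
    · rw [inSqrtVariable_mul, mul_left_comm]
      congr 1
      simpa [ho, pow_succ (-1 : RatFunc ℚ)] using h1
    · rw [I_zpow_odd, evalNegOne_mul, evalNegOne_C, h2]
      push_cast at hwC
      simp [ho]
      field_simp

namespace OrientedCurve

variable {r s n : ℕ} {Δ : Fin n → ℤ × ℤ} {F : Finset (Fin n)}

open RatFunc in
theorem endMult_eq (hΔ : ∀ i, Δ i ≠ 0) (F : Finset (Fin n)) (i : Fin n) :
    ∃ L : LaurentPolynomial ℚ,
      (if i ∈ F then fixedEndMult (weight (Δ i)) else freeEndMult (weight (Δ i))) =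
        (X + X⁻¹) ^ evenEndSign Δ F i * inSqrtVariable L ∧
      Complex.I ^ ((weight (Δ i) : ℤ) - 1) =
        (2 * Complex.I) ^ evenEndSign Δ F i * evalNegOne L := by
  by_cases hi : i ∈ F
  · simpa [evenEndSign, hi] using fixedEndMult_eq (weight (Δ i))
  · have hw : weight (Δ i) ≠ 0 := fun h => hΔ i <| by
      rw [weight, Int.gcd_eq_zero_iff] at h
      exact Prod.ext h.1 h.2
    simpa [evenEndSign, hi] using freeEndMult_eq hw

/-- The vertex `v` is of one of the types (1) to (6). -/
def IsBroccoliAt (C : OrientedCurve r s Δ F) (v : Fin C.k) : Prop :=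
  C.IsType1 v ∨ C.IsType2 v ∨ C.IsType3 v ∨ C.IsType4 v ∨ C.IsType5 v ∨ C.IsType6 v

open RatFunc in
/-- The local multiplicities at a vertex, where `N` is the excess of the order of vanishing at
`y = -1` over the contribution of the adjacent even edges. -/
theorem vertexMult_eq (C : OrientedCurve r s Δ F) (v : Fin C.k)
    (hv : C.IsTypeI v ∨ C.IsTypeII v ∨ C.IsTypeIII v) :
    ∃ (N : ℕ) (L : LaurentPolynomial ℚ),
      C.refinedVertexMult v =
        (X + X⁻¹) ^ (2 * N - (C.outEven v - C.inEven v) : ℤ) * inSqrtVariable L ∧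
      (N = 0 ↔ C.IsBroccoliAt v) ∧
      (C.IsBroccoliAt v → C.vertexMult v =
        (2 * Complex.I) ^ (2 * N - (C.outEven v - C.inEven v) : ℤ) * evalNegOne L) := by
  have hcard := C.card_edgesAt v
  have h2 := C.odd_edges_ne_one_of_card_two v
  have h3 := C.odd_edges_of_card_three v
  rw [hcard] at h2 h3
  clear hcard
  simp only [IsBroccoliAt, refinedVertexMult, vertexMult, IsTypeI, IsTypeII, IsTypeIII, IsType1,
    IsType2, IsType3, IsType4, IsType5, IsType6, HasVertexType] at hv ⊢
  obtain ⟨a, h_a⟩ : ∃ a, C.realMarks v = a := ⟨_, rfl⟩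
  obtain ⟨b, h_b⟩ : ∃ b, C.cplxMarks v = b := ⟨_, rfl⟩
  obtain ⟨oo, h_oo⟩ : ∃ oo, C.outOdd v = oo := ⟨_, rfl⟩
  obtain ⟨oe, h_oe⟩ : ∃ oe, C.outEven v = oe := ⟨_, rfl⟩
  obtain ⟨io, h_io⟩ : ∃ io, C.inOdd v = io := ⟨_, rfl⟩
  obtain ⟨ie, h_ie⟩ : ∃ ie, C.inEven v = ie := ⟨_, rfl⟩
  obtain ⟨m, h_m⟩ : ∃ m, C.mikh v = m := ⟨_, rfl⟩
  simp only [h_a, h_b, h_oo, h_oe, h_io, h_ie, h_m] at hv h2 h3 ⊢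
  clear h_a h_b h_oo h_oe h_io h_ie h_m
  rcases hv with ⟨rfl, rfl, ho, hi⟩ | ⟨rfl, rfl, ho, hi⟩ | ⟨rfl, rfl, ho, hi⟩
  · obtain ⟨rfl, rfl⟩ : io = 0 ∧ ie = 0 := by omega
    have h : oo = 2 ∧ oe = 0 ∨ oo = 0 ∧ oe = 2 := by have := h2 (by omega); omega
    rcases h with ⟨rfl, rfl⟩ | ⟨rfl, rfl⟩
    · exact ⟨0, 1, by simp [inSqrtVariable_one], by simp, by simp [evalNegOne_one]⟩
    -- Two outgoing even edges: not a broccoli vertex. The multiplicity is still `1`, since `2N - 2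
    -- = 0`.
    · exact ⟨1, 1, by simp [inSqrtVariable_one], by simp, by simp⟩
  · obtain ⟨h4, h5⟩ := h3 (by omega)
    rcases Nat.even_or_odd' m with ⟨c, rfl | rfl⟩
    -- An even Mikhalkin multiplicity rules out three odd edges, and `h4` rules out exactly one, so
    -- there are none or two.
    · have hm : oo + io ≠ 3 := fun h => Nat.not_odd_iff_even.2 (even_two_mul c) (h5.2 h)
      obtain ⟨L, hL, hL'⟩ := exists_laurent_sub_even c
      have h : oo = 1 ∧ oe = 0 ∧ io = 1 ∧ ie = 1 ∨ oo = 0 ∧ oe = 1 ∧ io = 0 ∧ ie = 2 ∨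
          oo = 0 ∧ oe = 1 ∧ io = 2 ∧ ie = 0 := by omega
      have hI : ((2 * c : ℕ) : ℂ) * Complex.I ^ (((2 * c : ℕ) : ℤ) - 1) =
          2 * Complex.I * evalNegOne L := by
        rw [I_zpow_even, hL']; push_cast; ring
      rcases h with ⟨rfl, rfl, rfl, rfl⟩ | ⟨rfl, rfl, rfl, rfl⟩ | ⟨rfl, rfl, rfl, rfl⟩
      · exact ⟨0, L, by simpa using hL, by simp, fun _ => by simpa using hI⟩
      · exact ⟨0, L, by simpa using hL, by simp, fun _ => by simpa using hI⟩
      -- Two incoming odd edges and one outgoing even edge: the factor has exponent `1` where the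
      -- edge count gives `-1`, hence `N = 1`.
      · exact ⟨1, L, by simpa using hL, by simp, by simp⟩
    · obtain ⟨rfl, rfl, rfl, rfl⟩ : oo = 1 ∧ oe = 0 ∧ io = 2 ∧ ie = 0 := by
        have := h5.1 ⟨c, rfl⟩
        omega
      obtain ⟨L, hL, hL'⟩ := exists_laurent_sub_odd c
      have hI := I_zpow_odd c
      rw [← hL'] at hI
      exact ⟨0, L, by simpa using hL, by simp, fun _ => by simpa using hI⟩
  · obtain ⟨h4, h5⟩ := h3 (by omega)
    obtain ⟨rfl, rfl⟩ : io = 0 ∧ ie = 0 := by omega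
    rcases Nat.even_or_odd' m with ⟨c, rfl | rfl⟩
    · have hm : oo + 0 ≠ 3 := fun h => Nat.not_odd_iff_even.2 (even_two_mul c) (h5.2 h)
      obtain ⟨L, hL, hL'⟩ := exists_laurent_add_even c
      have hI := I_zpow_even_eq c
      rw [← hL'] at hI
      have h : oo = 2 ∧ oe = 1 ∨ oo = 0 ∧ oe = 3 := by omega
      rcases h with ⟨rfl, rfl⟩ | ⟨rfl, rfl⟩
      · exact ⟨0, L, by simpa using hL, by simp, fun _ => by simpa using hI⟩
      -- Three outgoing even edges: the factor has exponent `-1` where the edge count gives `-3`,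
      -- hence `N = 1`.
      · exact ⟨1, L, by simpa using hL, by simp, by simp⟩
    · obtain ⟨rfl, rfl⟩ : oo = 3 ∧ oe = 0 := by
        have := h5.1 ⟨c, rfl⟩
        omega
      obtain ⟨L, hL, hL'⟩ := exists_laurent_add_odd c
      have hI : ((2 * c + 1 : ℕ) : ℂ) * Complex.I ^ (((2 * c + 1 : ℕ) : ℤ) - 1) =
          evalNegOne L := by
        rw [I_zpow_odd, hL']; push_cast; ring
      exact ⟨0, L, by simpa using hL, by simp, fun _ => by simpa using hI⟩

/-! ### From local factors to the multiplicity of a curve -/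

theorem prod_zpow_eq_zpow_sum {ι K : Type*} [Field K] {a : K} (ha : a ≠ 0) (t : Finset ι)
    (e : ι → ℤ) : ∏ i ∈ t, a ^ e i = a ^ ∑ i ∈ t, e i := by
  classical
  induction t using Finset.induction_on with
  | empty => simp
  | insert i t hi ih => rw [Finset.prod_insert hi, Finset.sum_insert hi, ih, zpow_add₀ ha]

open LaurentPolynomial in
/-- The refined multiplicity of a refined broccoli curve is a Laurent polynomial in `y`; its value
at `y = -1` is the multiplicity for broccoli curves, and zero for all other curves. -/
theorem IsRefinedBroccoli.exists_laurent {C : OrientedCurve r s Δ F} (hC : C.IsRefinedBroccoli)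
    (hΔ : ∀ i, Δ i ≠ 0) : ∃ L : LaurentPolynomial ℚ, C.refinedMult = inSqrtVariable L ∧
      (C.IsBroccoli → evalNegOne L = C.mult) ∧ (¬ C.IsBroccoli → evalNegOne L = 0) := by
  choose E hE hE' using endMult_eq hΔ F
  choose N V hV hN hV' using fun v => C.vertexMult_eq v (hC v)
  have hexp : ∑ i, evenEndSign Δ F i + ∑ v, (2 * N v - (C.outEven v - C.inEven v) : ℤ) =
      2 * (∑ v, N v : ℕ) := by
    rw [Finset.sum_sub_distrib, C.sum_outEven_sub_inEven, ← Finset.mul_sum]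
    push_cast
    ring
  have hX := RatFunc.X_ne_zero (K := ℚ)
  -- `y + 2 + y⁻¹ = (X + X⁻¹)²` turns the remaining even power of `X + X⁻¹` into a Laurent
  -- polynomial in `y`.
  refine ⟨(T 1 + LaurentPolynomial.C 2 + T (-1)) ^ (∑ v, N v) * ((∏ i, E i) * ∏ v, V v), ?_, fun hb => ?_,
    fun hb => ?_⟩
  · have hsq : inSqrtVariable (T 1 + LaurentPolynomial.C 2 + T (-1)) =
        (RatFunc.X + RatFunc.X⁻¹) ^ 2 := by
      rw [inSqrtVariable_add, inSqrtVariable_add, inSqrtVariable_T, inSqrtVariable_T,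
        inSqrtVariable_C, map_ofNat, mul_neg, zpow_neg, mul_one]
      norm_cast
      field_simp
      ring
    rw [refinedMult, Finset.prod_congr rfl fun i _ => hE i, Finset.prod_congr rfl fun v _ => hV v,
      Finset.prod_mul_distrib, Finset.prod_mul_distrib, mul_mul_mul_comm,
      prod_zpow_eq_zpow_sum X_add_inv_ne_zero, prod_zpow_eq_zpow_sum X_add_inv_ne_zero,
      ← zpow_add₀ X_add_inv_ne_zero, hexp, inSqrtVariable_mul, inSqrtVariable_mul,
      inSqrtVariable_prod, inSqrtVariable_prod, inSqrtVariable_pow, hsq, ← pow_mul]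
    norm_cast
  -- All excesses vanish, so the exponents of `2i` sum to zero, and only the values of the local
  -- Laurent polynomials remain.
  · have hN0 : ∑ v, N v = 0 := Finset.sum_eq_zero fun v _ => (hN v).2 (hb v)
    rw [hN0] at hexp ⊢
    rw [mult, Finset.prod_congr rfl fun i _ => hE' i,
      Finset.prod_congr rfl fun v _ => hV' v (hb v),
      Finset.prod_mul_distrib, Finset.prod_mul_distrib, mul_mul_mul_comm,
      prod_zpow_eq_zpow_sum two_mul_I_ne_zero, prod_zpow_eq_zpow_sum two_mul_I_ne_zero,
      ← zpow_add₀ two_mul_I_ne_zero, hexp, evalNegOne_mul, evalNegOne_mul,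
      evalNegOne_prod, evalNegOne_prod, pow_zero, evalNegOne_one]
    simp
  · have hN0 : ∑ v, N v ≠ 0 := fun h => hb fun v =>
      (hN v).1 (Finset.sum_eq_zero_iff.1 h v (Finset.mem_univ v))
    have h0 : evalNegOne (T 1 + LaurentPolynomial.C 2 + T (-1)) = 0 := by
      rw [evalNegOne_add, evalNegOne_add, evalNegOne_T, evalNegOne_T, evalNegOne_C]
      norm_num
    rw [evalNegOne_mul, evalNegOne_pow, h0, zero_pow hN0, zero_mul]

theorem Isom.isBroccoli {C D : OrientedCurve r s Δ F} (h : Isom C D) (hC : C.IsBroccoli) :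
    D.IsBroccoli := by
  obtain ⟨σ, h, -⟩ := h
  intro v
  obtain ⟨u, rfl⟩ := σ.surjective v
  have := hC u
  obtain ⟨h1, h2, h3, h4, h5, h6⟩ := h.hasVertexType u
  simpa only [IsType1, IsType2, IsType3, IsType4, IsType5, IsType6, HasVertexType, h1, h2, h3, h4,
    h5, h6] using this

end OrientedCurve

/-! ### Summation over the curves through given conditions -/

open OrientedCurve

variable {r s n : ℕ} {Δ : Fin n → ℤ × ℤ} {F : Finset (Fin n)}

open scoped Classical in
theorem exists_laurent_of_mem {P : Conditions r s Δ F} (hΔ : ∀ i, Δ i ≠ 0)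
    {q : Moduli r s Δ F} (hq : q ∈ refinedBroccoliCurvesThrough P) :
    ∃ L : LaurentPolynomial ℚ, q.refinedMult = inSqrtVariable L ∧
      evalNegOne L = if q ∈ broccoliCurvesThrough P then q.mult else 0 := by
  obtain ⟨C, -, hC, hev, rfl⟩ := hq
  obtain ⟨L, h1, h2, h3⟩ := hC.exists_laurent hΔ
  refine ⟨L, h1, ?_⟩
  split_ifs with h
  -- Membership only provides some broccoli representative `D` of the class; being broccoli is
  -- transported along the isomorphism to `C`.
  · obtain ⟨D, -, hD, -, hDC⟩ := h
    exact h2 (Isom.isBroccoli (Quotient.exact hDC) hD)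
  · exact h3 fun hb => h ⟨C, subset_closure _ hb, hb, hev, rfl⟩

theorem exists_laurent_invariant {P : Conditions r s Δ F} (hΔ : ∀ i, Δ i ≠ 0)
    (hfin : (refinedBroccoliCurvesThrough P).Finite) : ∃ L : LaurentPolynomial ℚ,
      refinedBroccoliInvariant P = inSqrtVariable L ∧ evalNegOne L = broccoliInvariant P := by
  classical
  choose L hL hL' using fun (q : Moduli r s Δ F) (hq : q ∈ hfin.toFinset) =>
    exists_laurent_of_mem hΔ (hfin.mem_toFinset.1 hq)
  refine ⟨LaurentPolynomial.C (Nat.card (symGroup Δ F) : ℚ)⁻¹ *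
    ∑ q ∈ hfin.toFinset.attach, L q.1 q.2, ?_, ?_⟩
  · rw [refinedBroccoliInvariant, inSqrtVariable_mul, inSqrtVariable_C, inSqrtVariable_sum,
      map_inv₀, ← natCast_ratFunc_eq, finsum_mem_eq_finite_toFinset_sum _ hfin,
      ← Finset.sum_attach]
    exact congrArg _ (Finset.sum_congr rfl fun q _ => hL q.1 q.2)
  · have hfin' := hfin.subset (broccoliCurvesThrough_subset P)
    rw [broccoliInvariant, evalNegOne_mul, evalNegOne_C, evalNegOne_sum,
      finsum_mem_eq_finite_toFinset_sum _ hfin', Finset.sum_congr rfl fun q _ => hL' q.1 q.2,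
      Finset.sum_attach hfin.toFinset fun q => if q ∈ broccoliCurvesThrough P then q.mult else 0,
      ← Finset.sum_filter]
    have : hfin.toFinset.filter (· ∈ broccoliCurvesThrough P) = hfin'.toFinset := by
      ext q
      simpa using fun h => broccoliCurvesThrough_subset P h
    rw [this]
    push_cast
    rfl

end Broccoli

theorem corollary3p14 {r s n : ℕ} (Δ : Fin n → ℤ × ℤ) (hΔ : ∀ i, Δ i ≠ 0) (F : Finset (Fin n))
    (hF : r + 2 * s + F.card + 1 = n) (P : Broccoli.Conditions r s Δ F)
    (hP : Broccoli.OrientedCurve.InGeneralPosition (Broccoli.refinedBroccoliSpace r s Δ F) P) :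
    Broccoli.OrientedCurve.InGeneralPosition (Broccoli.broccoliSpace r s Δ F) P ∧
    (Broccoli.refinedBroccoliCurvesThrough P).Finite ∧
    (Broccoli.broccoliCurvesThrough P).Finite ∧
    ∃ L : LaurentPolynomial ℚ,
      Broccoli.refinedBroccoliInvariant P = Broccoli.inSqrtVariable L ∧
      Broccoli.evalNegOne L = Broccoli.broccoliInvariant P := by
  have hfin := Broccoli.finite_refinedBroccoliCurvesThrough hF hP
  exact ⟨hP.anti fun _ h => h.isRefinedBroccoli, hfin,
    hfin.subset (Broccoli.broccoliCurvesThrough_subset P),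
    Broccoli.exists_laurent_invariant hΔ hfin⟩
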